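/- Let $k$ be a commutative ring and let $\mathbb 1$ be the initial operad ($k$ concentrated in arity $1$ and degree $0$). A differential graded $\mathbb 1$-algebra is just a chain complex of $k$-modules: the forgetful functor is an equivalence of categories. Let $A$ be a chain complex of $k$-modules (indexed by $\mathbb Z$, differential of degree $-1$). A *twisted complex* $X$ consists of modules $X_{p,q}$, $p\ge 0$, $q\in\mathbb Z$, and maps $d_i\colon X_{p,q}\to X_{p-i,q-1+i}$, $i\ge 0$, with $\sum_{i+j=n}d_id_j=0$ for all $n$; a *twisted map* $f\colon X\to Y$ consists of maps $f_i\colon X_{p,q}\to Y_{p-i,q+i}$, $i\ge0$, with $\sum_{i+j=n}d_if_j=\sum_{i+j=n}f_id_j$; it is an *$E^2$-equivalence* if $f_0$ induces an isomorphism on the $E^2$ pages of the spectral sequences of the filtrations by $p$. A *minimal model* of $A$ is an $E^2$-equivalence $f\colon X\to A$, where $A$ is placed in horizontal degree $p=0$, $d_0=0$ on $X$, and all $X_{p,q}$ are projective. Then each $(X_{*,q},d_1)$ is a projective resolution of $H_q(A)$ with augmentation $\rho\colon X_{0,q}\xrightarrow{f_0}\ker[A_q\to A_{q-1}]\twoheadrightarrow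 H_q(A)$. For a horizontal resolution of $H_*(A)$, i.e. a projective resolution $P_{*,q}\to H_q(A)$ for each $q\in\mathbb Z$, the derived operadic cohomology $H^{w,t}_{\mathbb 1}(H_*(A),H_*(A))$ is the cohomology of the complex $\prod_q\operatorname{Hom}_k(P_{w,q},H_{q-t}(A))$, $w\geq 0$, with differential $\psi\mapsto -(-1)^w\psi d_1$. The *derived universal Massey product* of $A$ is the class in bidegree $(2,-1)$, computed with the horizontal resolution $(X_{*,q},d_1)_q$ given by a minimal model, of the cocycle with components $\rho d_2\colon X_{2,q}\to H_{q+1}(A)$. Then: 1. for every horizontal resolution of $H_*(A)$ the canonical map $H^{2,-1}_{\mathbb 1}(H_*(A),H_*(A))\to\prod_{q\in\mathbb Z}\operatorname{Ext}^2_k(H_q(A),H_{q+1}(A))$, sending the class of a cocycle $\psi$ to the family of classes of its components, is an isomorphism; 2. $A$ has a minimal model, and for every minimal model of $A$ the derived universal Massey product is mapped by this isomorphism to the family whose component at $q$ is the negative of the class of the $2$-extension $$H_{q+1}(A)\hookrightarrow A_{q+1}/d(A_{q+2})\xrightarrow{\;d\;}\ker[d\colon A_q\to A_{q-1}]\twoheadrightarrow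 H_q(A).$$ Here the class in $\operatorname{Ext}^2_k(N,M)$ of a $2$-extension $M\hookrightarrow E_1\to E_0\twoheadrightarrow N$ is represented by the cocycle $P_2\to M$ obtained by lifting $\mathrm{id}_N$ to a map from a projective resolution $P$ of $N$ to the extension. -/

import Mathlib

open CategoryTheory CategoryTheory.Abelian

universe v u

noncomputable section

/-! ### Algebras over the initial operad -/

/-- The initial operad is the ground ring `R` concentrated in arity `1` and degree `0`, with zero
differential. A morphism of dg operads from it to the endomorphism operad of a chain complex is
therefore a morphism of `R`-algebras from `R` to the degree `0` cycles of arity `1` operations,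
i.e. to the algebra of chain endomorphisms. This is a differential graded algebra over it. -/
structure InitialOperadAlgebra (R : Type u) [CommRing R] where
  /-- the underlying chain complex -/
  complex : ChainComplex (ModuleCat.{v} R) ℤ
  /-- the action of the arity `1`, degree `0` operations -/
  act : R →ₐ[R] End complex

namespace InitialOperadAlgebra

variable {R : Type u} [CommRing R]

/-- Morphisms: chain maps compatible with the operations. -/
@[ext]
structure Hom (A B : InitialOperadAlgebra.{v} R) where
  /-- the underlying chain map -/
  map : A.complex ⟶ B.complex
  comm : ∀ r : R, A.act r ≫ map = map ≫ B.act r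

instance : Category (InitialOperadAlgebra.{v} R) where
  Hom := Hom
  id A := ⟨𝟙 _, fun r => by rw [Category.comp_id, Category.id_comp]⟩
  comp f g := ⟨f.map ≫ g.map, fun r => by
    rw [← Category.assoc, f.comm, Category.assoc, g.comm, Category.assoc]⟩
  id_comp f := Hom.ext (Category.id_comp f.map)
  comp_id f := Hom.ext (Category.comp_id f.map)
  assoc f g h := Hom.ext (Category.assoc f.map g.map h.map)

variable (R) in
/-- The underlying chain complex of an algebra over the initial operad. -/
def forget : InitialOperadAlgebra.{v} R ⥤ ChainComplex (ModuleCat.{v} R) ℤ where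
  obj A := A.complex
  map f := Hom.map f
  map_id _ := rfl
  map_comp _ _ := rfl

end InitialOperadAlgebra

/-! ### Twisted complexes and twisted maps -/

/-- A twisted complex, i.e. a derived homotopy algebra over the initial operad: bigraded modules
`X p q` (`p ≥ 0` the horizontal degree, `q` the vertical degree), and a differential of total
degree `-1` on `⨁ X p q` which does not raise the horizontal degree. The differential is given by
its components `d p q p' q' : X p q ⟶ X p' q'`; the component with `p' = p - i` and
`q' = q - 1 + i` is the piece `d_i`. -/
structure TwistedComplex (R : Type u) [CommRing R] where
  /-- the module in bidegree `(p, q)` -/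
  X : ℕ → ℤ → ModuleCat.{v} R
  /-- the components of the differential -/
  d (p : ℕ) (q : ℤ) (p' : ℕ) (q' : ℤ) : X p q ⟶ X p' q'
  shape : ∀ (p : ℕ) (q : ℤ) (p' : ℕ) (q' : ℤ),
    ¬ (p' ≤ p ∧ (p' : ℤ) + q' + 1 = p + q) → d p q p' q' = 0
  d_comp_d : ∀ (p : ℕ) (q : ℤ) (p' : ℕ) (q' : ℤ), (p' : ℤ) + q' + 2 = p + q →
    ∑ k ∈ Finset.range (p + 1), d p q k (p + q - 1 - k) ≫ d k (p + q - 1 - k) p' q' = 0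

/-- A twisted map, i.e. a derived `∞`-morphism over the initial operad: a chain map between the
total complexes which does not raise the horizontal degree, given by its components. The component
with `p' = p - i` and `q' = q + i` is the piece `f_i`. -/
structure TwistedMap {R : Type u} [CommRing R] (X Y : TwistedComplex.{v} R) where
  /-- the components of the map -/
  f (p : ℕ) (q : ℤ) (p' : ℕ) (q' : ℤ) : X.X p q ⟶ Y.X p' q'
  shape : ∀ (p : ℕ) (q : ℤ) (p' : ℕ) (q' : ℤ),
    ¬ (p' ≤ p ∧ (p' : ℤ) + q' = p + q) → f p q p' q' = 0
  comm : ∀ (p : ℕ) (q : ℤ) (p' : ℕ) (q' : ℤ), (p' : ℤ) + q' + 1 = p + q →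
    ∑ k ∈ Finset.range (p + 1), f p q k (p + q - k) ≫ Y.d k (p + q - k) p' q' =
    ∑ k ∈ Finset.range (p + 1), X.d p q k (p + q - 1 - k) ≫ f k (p + q - 1 - k) p' q'

namespace TwistedComplex

variable {R : Type u} [CommRing R]

/-- The bigraded module with `A_q` in bidegree `(0, q)` and zero in positive horizontal degrees. -/
def ofComplexX (A : ChainComplex (ModuleCat.{v} R) ℤ) : ℕ → ℤ → ModuleCat.{v} R
  | 0, q => A.X q
  | _ + 1, _ => ModuleCat.of R PUnit

/-- The components of the differential of a complex placed in horizontal degree `0`. -/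
def ofComplexD (A : ChainComplex (ModuleCat.{v} R) ℤ) :
    ∀ (p : ℕ) (q : ℤ) (p' : ℕ) (q' : ℤ), ofComplexX A p q ⟶ ofComplexX A p' q'
  | 0, q, 0, q' => A.d q q'
  | 0, _, _ + 1, _ => 0
  | _ + 1, _, _, _ => 0

/-- A chain complex, regarded as a twisted complex concentrated in horizontal degree `0`. -/
def ofComplex (A : ChainComplex (ModuleCat.{v} R) ℤ) : TwistedComplex.{v} R where
  X := ofComplexX A
  d := ofComplexD A
  shape := by
    rintro (_ | p) q (_ | p') q' h
    · refine A.shape _ _ fun h' => h ?_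
      simp only [ComplexShape.down_Rel] at h'
      refine ⟨le_rfl, ?_⟩
      push_cast
      lia
    all_goals rfl
  d_comp_d := by
    rintro (_ | p) q (_ | p') q' h
    · rw [Finset.sum_range_one]
      exact A.d_comp_d _ _ _
    · refine Finset.sum_eq_zero fun k _ => ?_
      rcases k with _ | k <;> exact Limits.comp_zero
    all_goals exact Finset.sum_eq_zero fun k _ => by simp [ofComplexD]

variable (X : TwistedComplex.{v} R)

/-- The representatives in `X p q` of the elements of the `E²` page of the spectral sequence of
the filtration by the horizontal degree: `d_0 x = 0` and `d_1 x` is in the image of `d_0`. -/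
def Z2 (p : ℕ) (q : ℤ) : Submodule R (X.X p q) :=
  LinearMap.ker (X.d p q p (q - 1)).hom ⊓
    ⨅ (p' : ℕ) (_ : p' + 1 = p),
      (LinearMap.range (X.d p' (q + 1) p' q).hom).comap (X.d p q p' q).hom

/-- The elements of `X p q` that vanish in the `E²` page: the sums of an element in the image of
`d_0` and of an element `d_1 w` with `d_0 w = 0`. -/
def B2 (p : ℕ) (q : ℤ) : Submodule R (X.X p q) :=
  LinearMap.range (X.d p (q + 1) p q).hom ⊔
    (LinearMap.ker (X.d (p + 1) q (p + 1) (q - 1)).hom).map (X.d (p + 1) q p q).hom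

/-- The `E²` page of the spectral sequence of the filtration by the horizontal degree. -/
abbrev E2 (p : ℕ) (q : ℤ) : Type v := X.Z2 p q ⧸ (X.B2 p q).submoduleOf (X.Z2 p q)

end TwistedComplex

namespace TwistedMap

variable {R : Type u} [CommRing R] {X Y : TwistedComplex.{v} R} (f : TwistedMap X Y)

lemma comm_zero (p : ℕ) (q q' : ℤ) (hq : q' + 1 = q) :
    f.f p q p q ≫ Y.d p q p q' = X.d p q p q' ≫ f.f p q' p q' := by
  have h := f.comm p q p q' (by lia)
  rw [Finset.sum_eq_single p, Finset.sum_eq_single p] at h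
  · have e1 : (p : ℤ) + q - p = q := by ring
    have e2 : (p : ℤ) + q - 1 - p = q' := by lia
    rwa [e1, e2] at h
  · intro k hk hkp
    rw [f.shape k _ p q' (by simp only [Finset.mem_range] at hk; lia)]
    simp
  · simp
  · intro k hk hkp
    rw [Y.shape k _ p q' (by simp only [Finset.mem_range] at hk; lia)]
    simp
  · simp

lemma comm_one (p : ℕ) (q q' : ℤ) (hq : q' + 1 = q) :
    f.f (p + 1) q p (q + 1) ≫ Y.d p (q + 1) p q + f.f (p + 1) q (p + 1) q ≫ Y.d (p + 1) q p q =
      X.d (p + 1) q p q ≫ f.f p q p q + X.d (p + 1) q (p + 1) q' ≫ f.f (p + 1) q' p q := by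
  have h := f.comm (p + 1) q p q (by push_cast; lia)
  rw [Finset.sum_range_succ, Finset.sum_range_succ, Finset.sum_eq_zero, zero_add,
    Finset.sum_range_succ, Finset.sum_range_succ, Finset.sum_eq_zero, zero_add] at h
  · have e1 : ((p + 1 : ℕ) : ℤ) + q - p = q + 1 := by push_cast; ring
    have e2 : ((p + 1 : ℕ) : ℤ) + q - 1 - p = q := by push_cast; ring
    have e3 : ((p + 1 : ℕ) : ℤ) + q - (p + 1 : ℕ) = q := by push_cast; ring
    have e4 : ((p + 1 : ℕ) : ℤ) + q - 1 - (p + 1 : ℕ) = q' := by push_cast; lia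
    rwa [e1, e2, e3, e4] at h
  · intro k hk
    rw [f.shape k _ p q (by simp only [Finset.mem_range] at hk; lia)]
    simp
  · intro k hk
    rw [Y.shape k _ p q (by simp only [Finset.mem_range] at hk; lia)]
    simp

lemma comm_zero_apply (p : ℕ) (q q' : ℤ) (hq : q' + 1 = q) (x : X.X p q) :
    (Y.d p q p q').hom ((f.f p q p q).hom x) = (f.f p q' p q').hom ((X.d p q p q').hom x) :=
  congrArg (fun g => g.hom x) (f.comm_zero p q q' hq)

lemma comm_one_apply (p : ℕ) (q q' : ℤ) (hq : q' + 1 = q) (x : X.X (p + 1) q) :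
    (Y.d p (q + 1) p q).hom ((f.f (p + 1) q p (q + 1)).hom x) +
        (Y.d (p + 1) q p q).hom ((f.f (p + 1) q (p + 1) q).hom x) =
      (f.f p q p q).hom ((X.d (p + 1) q p q).hom x) +
        (f.f (p + 1) q' p q).hom ((X.d (p + 1) q (p + 1) q').hom x) :=
  congrArg (fun g => g.hom x) (f.comm_one p q q' hq)

lemma map_Z2 (p : ℕ) (q : ℤ) (x : X.X p q) (hx : x ∈ X.Z2 p q) :
    (f.f p q p q).hom x ∈ Y.Z2 p q := by
  simp only [TwistedComplex.Z2, Submodule.mem_inf, LinearMap.mem_ker, Submodule.mem_iInf,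
    Submodule.mem_comap, LinearMap.mem_range] at hx ⊢
  refine ⟨by rw [f.comm_zero_apply p q (q - 1) (by lia), hx.1, map_zero], ?_⟩
  rintro p' rfl
  obtain ⟨y, hy⟩ := hx.2 p' rfl
  have h := f.comm_one_apply p' q (q - 1) (by lia) x
  rw [hx.1, map_zero, add_zero, ← hy, ← f.comm_zero_apply p' (q + 1) q rfl] at h
  exact ⟨(f.f p' (q + 1) p' (q + 1)).hom y - (f.f (p' + 1) q p' (q + 1)).hom x, by
    rw [map_sub, ← h, add_sub_cancel_left]⟩

lemma map_B2 (p : ℕ) (q : ℤ) (x : X.X p q) (hx : x ∈ X.B2 p q) :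
    (f.f p q p q).hom x ∈ Y.B2 p q := by
  simp only [TwistedComplex.B2, Submodule.mem_sup, LinearMap.mem_range, Submodule.mem_map,
    LinearMap.mem_ker] at hx ⊢
  obtain ⟨_, ⟨z, rfl⟩, _, ⟨w, hw, rfl⟩, rfl⟩ := hx
  have h := f.comm_one_apply p q (q - 1) (by lia) w
  rw [hw, map_zero, add_zero] at h
  refine ⟨_, ⟨(f.f p (q + 1) p (q + 1)).hom z + (f.f (p + 1) q p (q + 1)).hom w, rfl⟩,
    _, ⟨(f.f (p + 1) q (p + 1) q).hom w, ?_, rfl⟩, ?_⟩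
  · rw [f.comm_zero_apply (p + 1) q (q - 1) (by lia), hw, map_zero]
  · rw [map_add, map_add, add_assoc, h, f.comm_zero_apply p (q + 1) q rfl]

/-- The map induced on `E²` pages by the piece `f_0`. -/
def E2map (p : ℕ) (q : ℤ) : X.E2 p q →ₗ[R] Y.E2 p q :=
  Submodule.mapQ _ _ ((f.f p q p q).hom.restrict (f.map_Z2 p q))
    fun x hx => f.map_B2 p q x hx

/-- An `E²`-equivalence: a twisted map inducing an isomorphism on `E²` pages. -/
def IsE2Equivalence : Prop :=
  ∀ (p : ℕ) (q : ℤ), Function.Bijective (f.E2map p q)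

end TwistedMap

/-! ### Minimal models and horizontal resolutions -/

/-- A (derived) minimal model of a chain complex `A`: an `E²`-equivalence to `A` from a twisted
complex of projective modules with `d_0 = 0`. -/
structure MinimalModel {R : Type u} [CommRing R] (A : ChainComplex (ModuleCat.{v} R) ℤ) where
  /-- the minimal twisted complex -/
  model : TwistedComplex.{v} R
  minimal : ∀ (p : ℕ) (q q' : ℤ), model.d p q p q' = 0
  projective : ∀ (p : ℕ) (q : ℤ), Projective (model.X p q)
  /-- the comparison map -/
  map : TwistedMap model (TwistedComplex.ofComplex A)
  isE2Equivalence : map.IsE2Equivalence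

/-- A horizontal resolution of a graded module `H`, as an algebra over the initial operad: a
projective resolution of each `H q`. The module in bidegree `(p, q)` is `(P q).complex.X p` and
the horizontal differential is the differential of `(P q).complex`. -/
abbrev HorizontalResolution {R : Type u} [CommRing R] (H : ℤ → ModuleCat.{v} R) :=
  ∀ q : ℤ, ProjectiveResolution (H q)

namespace MinimalModel

variable {R : Type u} [CommRing R] {A : ChainComplex (ModuleCat.{v} R) ℤ} (m : MinimalModel A)

lemma d_one_comp_d_one (p : ℕ) (q : ℤ) :
    m.model.d (p + 2) q (p + 1) q ≫ m.model.d (p + 1) q p q = 0 := by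
  have h := m.model.d_comp_d (p + 2) q p q (by push_cast; lia)
  rw [Finset.sum_eq_single (p + 1)] at h
  · have e : ((p + 2 : ℕ) : ℤ) + q - 1 - (p + 1 : ℕ) = q := by push_cast; ring
    rwa [e] at h
  · intro k hk hkp
    rcases lt_trichotomy k (p + 1) with h1 | h1 | h1
    · rcases Nat.lt_or_ge k p with h2 | h2
      · rw [m.model.shape k _ p q (by lia)]
        simp
      · obtain rfl : k = p := by lia
        rw [m.minimal]
        simp
    · exact absurd h1 hkp
    · obtain rfl : k = p + 2 := by simp only [Finset.mem_range] at hk; lia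
      rw [m.minimal]
      simp
  · simp

/-- The horizontal complex `(X_{*,q}, d_1)` of the minimal twisted complex. -/
def row (q : ℤ) : ChainComplex (ModuleCat.{v} R) ℕ :=
  ChainComplex.of (fun p => m.model.X p q) (fun p => m.model.d (p + 1) q p q)
    fun p => m.d_one_comp_d_one p q

/-- The piece `f_0` in horizontal degree `0`. -/
def f₀ (q : ℤ) : m.model.X 0 q ⟶ A.X q := m.map.f 0 q 0 q

/-- The piece `f_1` in horizontal degree `1`. -/
def f₁ (q : ℤ) : m.model.X 1 q ⟶ A.X (q + 1) := m.map.f 1 q 0 (q + 1)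

lemma f₀_comp_d (q q' : ℤ) : m.f₀ q ≫ A.d q q' = 0 := by
  by_cases hq : q' + 1 = q
  · have h := m.map.comm_zero 0 q q' hq
    rw [m.minimal, Limits.zero_comp] at h
    exact h
  · rw [A.shape _ _ (by simpa using hq), Limits.comp_zero]

/-- The augmentation `ρ`: the composite of `f_0`, with values in cycles, and of the projection
onto homology. -/
def ρ (q : ℤ) : m.model.X 0 q ⟶ A.homology q :=
  A.liftCycles (m.f₀ q) (q - 1) (by simp) (m.f₀_comp_d q (q - 1)) ≫ A.homologyπ q

lemma Z2_succ (p : ℕ) (q : ℤ) :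
    m.model.Z2 (p + 1) q = LinearMap.ker (m.model.d (p + 1) q p q).hom := by
  ext x
  simp only [TwistedComplex.Z2, Submodule.mem_inf, LinearMap.mem_ker, Submodule.mem_iInf,
    Submodule.mem_comap, LinearMap.mem_range, m.minimal]
  refine ⟨fun h => ?_, fun h => ⟨rfl, ?_⟩⟩
  · obtain ⟨y, hy⟩ := h.2 p rfl
    exact hy.symm
  · rintro p' hp
    obtain rfl : p' = p := by lia
    exact ⟨0, h.symm⟩

lemma Z2_zero (q : ℤ) : m.model.Z2 0 q = ⊤ := by
  ext x
  simp [TwistedComplex.Z2, m.minimal]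

lemma B2_eq (p : ℕ) (q : ℤ) :
    m.model.B2 p q = LinearMap.range (m.model.d (p + 1) q p q).hom := by
  simp only [TwistedComplex.B2, m.minimal]
  rw [ModuleCat.hom_zero, ModuleCat.hom_zero, LinearMap.range_zero, bot_sup_eq,
    LinearMap.ker_zero, Submodule.map_top]

lemma row_exact (p : ℕ) (q : ℤ) (x : m.model.X (p + 1) q)
    (hx : (m.model.d (p + 1) q p q).hom x = 0) :
    ∃ y, (m.model.d (p + 2) q (p + 1) q).hom y = x := by
  have hinj := (m.isE2Equivalence (p + 1) q).1
  have hxZ : x ∈ m.model.Z2 (p + 1) q := by rw [m.Z2_succ]; exact hx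
  have h0 : m.map.E2map (p + 1) q (Submodule.Quotient.mk ⟨x, hxZ⟩) =
      m.map.E2map (p + 1) q 0 := by
    rw [map_zero]
    refine (Submodule.Quotient.mk_eq_zero _).2 ?_
    change (m.map.f (p + 1) q (p + 1) q).hom x ∈ (TwistedComplex.ofComplex A).B2 (p + 1) q
    have : (m.map.f (p + 1) q (p + 1) q).hom x = 0 := Subsingleton.elim (α := PUnit) _ _
    rw [this]
    exact Submodule.zero_mem _
  have h1 := (Submodule.Quotient.mk_eq_zero _).1 (hinj h0)
  have h2 : x ∈ m.model.B2 (p + 1) q := h1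
  rw [m.B2_eq] at h2
  exact h2

lemma ofComplex_Z2_zero (q : ℤ) (a : A.X q) :
    a ∈ (TwistedComplex.ofComplex A).Z2 0 q ↔ (A.d q (q - 1)).hom a = 0 := by
  refine ⟨fun h => h.1, fun h => ⟨h, ?_⟩⟩
  refine (Submodule.mem_iInf _).2 fun p' => (Submodule.mem_iInf _).2 fun hp' => ?_
  exact absurd hp' (by lia)

lemma B2_eq_of_d_eq_zero (T : TwistedComplex.{v} R) (p : ℕ) (q : ℤ)
    (h : T.d (p + 1) q p q = 0) : T.B2 p q = LinearMap.range (T.d p (q + 1) p q).hom := by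
  rw [TwistedComplex.B2, h, ModuleCat.hom_zero, Submodule.map_zero, sup_bot_eq]

lemma ofComplex_B2_zero (q : ℤ) (a : A.X q) :
    a ∈ (TwistedComplex.ofComplex A).B2 0 q ↔ ∃ b, (A.d (q + 1) q).hom b = a := by
  rw [B2_eq_of_d_eq_zero _ 0 q rfl]
  exact Iff.rfl

lemma ρ_surjective (q : ℤ) : Function.Surjective (m.ρ q).hom := by
  intro h
  obtain ⟨z, rfl⟩ := (ModuleCat.epi_iff_surjective (A.homologyπ q)).1 inferInstance h
  have hz : (A.iCycles q).hom z ∈ (TwistedComplex.ofComplex A).Z2 0 q :=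
    (ofComplex_Z2_zero q _).2 (congrArg (fun g => g.hom z) (A.iCycles_d q (q - 1)))
  obtain ⟨e, he⟩ := (m.isE2Equivalence 0 q).2 (Submodule.Quotient.mk ⟨_, hz⟩)
  obtain ⟨⟨x, hx⟩, rfl⟩ := Submodule.Quotient.mk_surjective _ e
  have h1 := (Submodule.Quotient.eq _).1 he
  have h2 : (m.f₀ q).hom x - (A.iCycles q).hom z ∈ (TwistedComplex.ofComplex A).B2 0 q := h1
  obtain ⟨b, hb⟩ := (ofComplex_B2_zero q _).1 h2
  refine ⟨x, ?_⟩
  have h3 : (A.liftCycles (m.f₀ q) (q - 1) (by simp) (m.f₀_comp_d q (q - 1))).hom x =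
      z + (A.toCycles (q + 1) q).hom b := by
    refine (ModuleCat.mono_iff_injective (A.iCycles q)).1 inferInstance ?_
    have e1 := congrArg (fun g => g.hom x)
      (A.liftCycles_i (m.f₀ q) (q - 1) (by simp) (m.f₀_comp_d q (q - 1)))
    have e2 := congrArg (fun g => g.hom b) (A.toCycles_i (q + 1) q)
    change (A.iCycles q).hom _ = (A.iCycles q).hom _
    refine e1.trans ?_
    rw [map_add]
    refine Eq.trans ?_ (congrArg (fun t => (A.iCycles q).hom z + t) e2.symm)
    rw [hb, add_sub_cancel]
  have h4 := congrArg (fun g => g.hom b) (A.toCycles_comp_homologyπ (q + 1) q)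
  refine (congrArg (A.homologyπ q).hom h3).trans ?_
  rw [map_add]
  refine Eq.trans (congrArg (fun t => (A.homologyπ q).hom z + t) h4) ?_
  exact add_zero _

lemma ρ_exact (q : ℤ) (x : m.model.X 0 q) (hx : (m.ρ q).hom x = 0) :
    ∃ y, (m.model.d 1 q 0 q).hom y = x := by
  have hex := (ShortComplex.moduleCat_exact_iff _).1
    (ShortComplex.exact_of_g_is_cokernel
      (ShortComplex.mk _ _ (A.toCycles_comp_homologyπ (q + 1) q))
      (A.homologyIsCokernel (q + 1) q (by simp)))
  obtain ⟨b, hb⟩ := hex _ hx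
  have e1 := congrArg (fun g => g.hom x)
    (A.liftCycles_i (m.f₀ q) (q - 1) (by simp) (m.f₀_comp_d q (q - 1)))
  have e2 := congrArg (fun g => g.hom b) (A.toCycles_i (q + 1) q)
  have h1 : (A.d (q + 1) q).hom b = (m.f₀ q).hom x :=
    e2.symm.trans ((congrArg (A.iCycles q).hom hb).trans e1)
  have hxZ : x ∈ m.model.Z2 0 q := by rw [m.Z2_zero]; trivial
  have h0 : m.map.E2map 0 q (Submodule.Quotient.mk ⟨x, hxZ⟩) = m.map.E2map 0 q 0 := by
    rw [map_zero]
    refine (Submodule.Quotient.mk_eq_zero _).2 ?_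
    change (m.f₀ q).hom x ∈ (TwistedComplex.ofComplex A).B2 0 q
    exact (ofComplex_B2_zero q _).2 ⟨b, h1⟩
  have h1 := (Submodule.Quotient.mk_eq_zero _).1 ((m.isE2Equivalence 0 q).1 h0)
  have h2 : x ∈ m.model.B2 0 q := h1
  rw [m.B2_eq] at h2
  exact h2

lemma f₁_comp_d (q : ℤ) : m.f₁ q ≫ A.d (q + 1) q = m.model.d 1 q 0 q ≫ m.f₀ q := by
  have h := m.map.comm_one 0 q (q - 1) (by lia)
  rw [m.minimal, Limits.zero_comp, add_zero] at h
  have h1 : (TwistedComplex.ofComplex A).d (0 + 1) q 0 q = 0 := rfl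
  rw [h1, Limits.comp_zero, add_zero] at h
  exact h

lemma d_one_comp_ρ (q : ℤ) : m.model.d 1 q 0 q ≫ m.ρ q = 0 := by
  have h2 : m.model.d 1 q 0 q ≫
      A.liftCycles (m.f₀ q) (q - 1) (by simp) (m.f₀_comp_d q (q - 1)) =
      m.f₁ q ≫ A.toCycles (q + 1) q := by
    rw [← cancel_mono (A.iCycles q), Category.assoc, Category.assoc, A.liftCycles_i,
      A.toCycles_i, m.f₁_comp_d]
  rw [ρ, reassoc_of% h2, A.toCycles_comp_homologyπ, Limits.comp_zero]

lemma row_d (p : ℕ) (q : ℤ) : (m.row q).d (p + 1) p = m.model.d (p + 1) q p q :=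
  ChainComplex.of_d (fun p => m.model.X p q) (fun p => m.model.d (p + 1) q p q) p

/-- The augmentation of the horizontal complex as a chain map. -/
def rowπ (q : ℤ) : m.row q ⟶ (ChainComplex.single₀ (ModuleCat.{v} R)).obj (A.homology q) :=
  (ChainComplex.toSingle₀Equiv (m.row q) (A.homology q)).symm
    ⟨m.ρ q, by rw [m.row_d]; exact m.d_one_comp_ρ q⟩

lemma rowπ_f_zero (q : ℤ) : (m.rowπ q).f 0 = m.ρ q :=
  ChainComplex.toSingle₀Equiv_symm_apply_f_zero _ _

lemma quasiIso_rowπ (q : ℤ) : QuasiIso (m.rowπ q) := ⟨fun p => by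
  rcases p with _ | p
  · rw [ChainComplex.quasiIsoAt₀_iff, ShortComplex.quasiIso_iff_of_zeros' _ rfl rfl rfl]
    constructor
    · rw [ShortComplex.moduleCat_exact_iff]
      intro x hx
      refine Exists.imp (fun y hy => ?_) (m.ρ_exact q x ?_)
      · refine Eq.trans ?_ hy
        exact congrArg (fun g => g.hom y) (m.row_d 0 q)
      · refine Eq.trans ?_ hx
        exact congrArg (fun g => g.hom x) (m.rowπ_f_zero q).symm
    · rw [ModuleCat.epi_iff_surjective]
      intro h
      obtain ⟨x, hx⟩ := m.ρ_surjective q h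
      refine ⟨x, Eq.trans ?_ hx⟩
      exact congrArg (fun g => g.hom x) (m.rowπ_f_zero q)
  · rw [quasiIsoAt_iff_exactAt' _ _ (ChainComplex.exactAt_succ_single_obj _ _),
      HomologicalComplex.exactAt_iff' _ (p + 2) (p + 1) p (by simp) (by simp),
      ShortComplex.moduleCat_exact_iff]
    intro x hx
    refine Exists.imp (fun y hy => ?_) (m.row_exact p q x ?_)
    · refine Eq.trans ?_ hy
      exact congrArg (fun g => g.hom y) (m.row_d (p + 1) q)
    · refine Eq.trans ?_ hx
      exact congrArg (fun g => g.hom x) (m.row_d p q).symm⟩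

/-- The horizontal resolution of the homology induced by a minimal model: the horizontal complexes
`(X_{*,q}, d_1)` with the augmentations `ρ`. -/
def horizontalResolution : HorizontalResolution (fun q => A.homology q) := fun q =>
  { complex := m.row q
    projective := fun p => m.projective p q
    π := m.rowπ q
    quasiIso := m.quasiIso_rowπ q }

end MinimalModel

/-! ### Derived operadic cohomology over the initial operad -/

/-- The pairs of degrees `(q, q')` with `q' = q - t`. -/
abbrev DegreePair (t : ℤ) : Type := {j : ℤ × ℤ // j.2 + t = j.1}

namespace HorizontalResolution

variable {R : Type u} [CommRing R] {H : ℤ → ModuleCat.{v} R} (P : HorizontalResolution H)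
  (M : ℤ → ModuleCat.{v} R)

/-- The operadic cochains of bidegree `(w, t)` over the initial operad, with coefficients in the
graded module `M`: the product over all `q` of the modules of maps from the module in bidegree
`(w, q)` of the resolution to `M q'`, with `q' = q - t`. -/
abbrev Cochain (w : ℕ) (t : ℤ) : Type v :=
  ∀ j : DegreePair t, (P j.1.1).complex.X w ⟶ M j.1.2

/-- The differential of the operadic cochain complex, `d ψ = -(-1)^w ψ d_1`. -/
def δ (w : ℕ) (t : ℤ) : P.Cochain M w t →ₗ[R] P.Cochain M (w + 1) t where
  toFun ψ := fun j => (-1 : R) ^ (w + 1) • ((P j.1.1).complex.d (w + 1) w ≫ ψ j)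
  map_add' ψ φ := by
    funext j
    simp only [Pi.add_apply, Preadditive.comp_add, smul_add]
  map_smul' r ψ := by
    funext j
    simp only [Pi.smul_apply, Linear.comp_smul, RingHom.id_apply]
    rw [smul_comm]

/-- The cocycles of bidegree `(w, t)`. -/
def cocycles (w : ℕ) (t : ℤ) : Submodule R (P.Cochain M w t) := LinearMap.ker (P.δ M w t)

/-- The coboundaries of bidegree `(w, t)`. -/
def coboundaries : (w : ℕ) → (t : ℤ) → Submodule R (P.Cochain M w t)
  | 0, _ => ⊥
  | w + 1, t => LinearMap.range (P.δ M w t)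

/-- The cohomology of the operadic cochain complex of a horizontal resolution of `H`, that is, the
derived operadic cohomology of bidegree `(w, t)` of `H` with coefficients in `M`, over the initial
operad. -/
abbrev Cohomology (w : ℕ) (t : ℤ) : Type v :=
  P.cocycles M w t ⧸ (P.coboundaries M w t).submoduleOf (P.cocycles M w t)

variable {P M}

lemma d_comp_eq_zero {w : ℕ} {t : ℤ} {ψ : P.Cochain M w t} (hψ : ψ ∈ P.cocycles M w t)
    (j : DegreePair t) : (P j.1.1).complex.d (w + 1) w ≫ ψ j = 0 := by
  have h1 : (-1 : R) ^ (w + 1) • ((P j.1.1).complex.d (w + 1) w ≫ ψ j) = 0 :=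
    congrFun (LinearMap.mem_ker.1 hψ) j
  have h2 := congrArg (fun g => (-1 : R) ^ (w + 1) • g) h1
  simpa only [smul_smul, ← mul_pow, neg_mul_neg, one_mul, one_pow, one_smul, smul_zero] using h2

variable (P M)

variable [Small.{v} R]

/-- The map sending a cocycle `ψ` to the family of elements of `Ext` groups represented by its
components. -/
def cocyclesToExt (w : ℕ) (t : ℤ) :
    P.cocycles M w t →ₗ[R] ∀ j : DegreePair t, Ext (H j.1.1) (M j.1.2) w where
  toFun ψ := fun j => (P j.1.1).extMk (ψ.1 j) (w + 1) rfl (d_comp_eq_zero ψ.2 j)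
  map_add' ψ φ := by
    funext j
    simp only [Pi.add_apply, ProjectiveResolution.add_extMk]
    rfl
  map_smul' r ψ := by
    funext j
    simp only [Pi.smul_apply, RingHom.id_apply, Ext.smul_eq_comp_mk₀,
      ProjectiveResolution.extMk_comp_mk₀]
    simp

lemma coboundaries_le_ker (w : ℕ) (t : ℤ) :
    (P.coboundaries M w t).submoduleOf (P.cocycles M w t) ≤
      LinearMap.ker (P.cocyclesToExt M w t) := by
  rintro ⟨ψ, hψ⟩ hb
  rw [LinearMap.mem_ker]
  funext j
  change (P j.1.1).extMk (ψ j) (w + 1) rfl (d_comp_eq_zero hψ j) = 0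
  rcases w with _ | w
  · have h0 : ψ = 0 := hb
    subst h0
    exact (P j.1.1).extMk_zero _ _
  · obtain ⟨φ, hφ⟩ : ∃ φ, P.δ M w t φ = ψ := hb
    rw [(P j.1.1).extMk_eq_zero_iff _ _ _ _ w rfl]
    refine ⟨(-1 : R) ^ (w + 1) • φ j, ?_⟩
    rw [Linear.comp_smul]
    exact congrFun hφ j

/-- The canonical map from the derived operadic cohomology of bidegree `(w, t)` to the product over
`q` of the modules `Ext^w(H_q, M_{q-t})`. -/
def toExt (w : ℕ) (t : ℤ) :
    P.Cohomology M w t →ₗ[R] ∀ j : DegreePair t, Ext (H j.1.1) (M j.1.2) w :=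
  Submodule.liftQ _ (P.cocyclesToExt M w t) (P.coboundaries_le_ker M w t)

end HorizontalResolution

/-! ### The derived universal Massey product -/

namespace MinimalModel

variable {R : Type u} [CommRing R] {A : ChainComplex (ModuleCat.{v} R) ℤ} (m : MinimalModel A)

/-- The cochain of bidegree `(2, -1)` given by the composites of
`d_2 : X_{2,q} ⟶ X_{0,q+1}` and `ρ : X_{0,q+1} ⟶ H_{q+1}(A)`. -/
def masseyCochain :
    m.horizontalResolution.Cochain (fun q => A.homology q) 2 (-1) :=
  fun j => (m.model.d 2 j.1.1 0 j.1.2 ≫ m.ρ j.1.2 :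
    m.model.X 2 j.1.1 ⟶ A.homology j.1.2)

lemma d_one_comp_d_two (q : ℤ) :
    m.model.d 3 q 2 q ≫ m.model.d 2 q 0 (q + 1) +
      m.model.d 3 q 1 (q + 1) ≫ m.model.d 1 (q + 1) 0 (q + 1) = 0 := by
  have h := m.model.d_comp_d 3 q 0 (q + 1) (by push_cast; lia)
  rw [Finset.sum_range_succ, Finset.sum_range_succ, Finset.sum_range_succ,
    Finset.sum_range_one] at h
  have e2 : ((3 : ℕ) : ℤ) + q - 1 - (2 : ℕ) = q := by push_cast; ring
  have e1 : ((3 : ℕ) : ℤ) + q - 1 - (1 : ℕ) = q + 1 := by push_cast; ring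
  rw [e2, e1, m.minimal 0, m.minimal 3, Limits.comp_zero, Limits.zero_comp, zero_add,
    add_zero] at h
  exact (add_comm _ _).trans h

lemma masseyCochain_mem : m.masseyCochain ∈
    m.horizontalResolution.cocycles (fun q => A.homology q) 2 (-1) := by
  refine LinearMap.mem_ker.2 ?_
  funext j
  obtain ⟨⟨q, q'⟩, h⟩ := j
  obtain rfl : q' = q + 1 := by
    dsimp only at h
    lia
  have h1 : m.model.d 3 q 2 q ≫ m.model.d 2 q 0 (q + 1) ≫ m.ρ (q + 1) = 0 := by
    rw [← Category.assoc, eq_neg_of_add_eq_zero_left (m.d_one_comp_d_two q),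
      Preadditive.neg_comp, Category.assoc, m.d_one_comp_ρ, Limits.comp_zero, neg_zero]
  have h2 : (m.row q).d 3 2 ≫ (m.model.d 2 q 0 (q + 1) ≫ m.ρ (q + 1) :
      m.model.X 2 q ⟶ A.homology (q + 1)) = 0 := by
    rw [m.row_d 2 q]
    exact h1
  change (-1 : R) ^ 3 • ((m.row q).d 3 2 ≫ (m.model.d 2 q 0 (q + 1) ≫ m.ρ (q + 1) :
      m.model.X 2 q ⟶ A.homology (q + 1))) = 0
  rw [h2, smul_zero]

/-- The derived universal Massey product of the chain complex `A`, as the cohomology class of the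
cocycle defined by a minimal model. -/
def universalMassey :
    m.horizontalResolution.Cohomology (fun q => A.homology q) 2 (-1) :=
  Submodule.Quotient.mk ⟨m.masseyCochain, m.masseyCochain_mem⟩

end MinimalModel

/-! ### Classes of `2`-extensions -/

/-- A `2`-extension `M ↪ E₁ ⟶ E₀ ↠ N`, i.e. an exact sequence `0 ⟶ M ⟶ E₁ ⟶ E₀ ⟶ N ⟶ 0`. -/
structure TwoExtension {R : Type u} [CommRing R] (N M : ModuleCat.{v} R) where
  /-- the left middle term -/
  E₁ : ModuleCat.{v} R
  /-- the right middle term -/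
  E₀ : ModuleCat.{v} R
  /-- the inclusion -/
  i : M ⟶ E₁
  /-- the middle map -/
  d : E₁ ⟶ E₀
  /-- the projection -/
  p : E₀ ⟶ N
  i_d : i ≫ d = 0
  d_p : d ≫ p = 0
  mono_i : Mono i
  exact₁ : (ShortComplex.mk i d i_d).Exact
  exact₀ : (ShortComplex.mk d p d_p).Exact
  epi_p : Epi p

namespace TwoExtension

variable {R : Type u} [CommRing R] {N M : ModuleCat.{v} R} (E : TwoExtension N M)

/-- A lift of the identity of `N` to a map from a projective resolution of `N` to a `2`-extension,
i.e. a commutative diagram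
```
P₃ ⟶ P₂ ⟶ P₁ ⟶ P₀ ⟶ N
      |φ   |g₁  |g₀  ‖
0 ⟶  M ⟶ E₁ ⟶ E₀ ⟶ N
```
(the map `φ` is then a cocycle, see `Lift.d_comp_φ`). -/
structure Lift (P : ProjectiveResolution N) where
  /-- the map in degree `0` -/
  g₀ : P.complex.X 0 ⟶ E.E₀
  /-- the map in degree `1` -/
  g₁ : P.complex.X 1 ⟶ E.E₁
  /-- the map in degree `2` -/
  φ : P.complex.X 2 ⟶ M
  comm₀ : g₀ ≫ E.p = P.π.f 0
  comm₁ : g₁ ≫ E.d = P.complex.d 1 0 ≫ g₀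
  comm₂ : φ ≫ E.i = P.complex.d 2 1 ≫ g₁

variable {E} in
lemma Lift.d_comp_φ {P : ProjectiveResolution N} (l : E.Lift P) :
    P.complex.d 3 2 ≫ l.φ = 0 := by
  have := E.mono_i
  rw [← cancel_mono E.i, Category.assoc, l.comm₂, P.complex.d_comp_d_assoc, Limits.zero_comp,
    Limits.zero_comp]

lemma nonempty_lift (P : ProjectiveResolution N) : Nonempty (E.Lift P) := by
  have := E.mono_i
  have hp : Epi E.p := E.epi_p
  let π₀ : P.complex.X 0 ⟶ N := P.π.f 0
  let g₀ : P.complex.X 0 ⟶ E.E₀ := Projective.factorThru π₀ E.p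
  have h₀ : g₀ ≫ E.p = π₀ := Projective.factorThru_comp _ _
  have k₀ : (P.complex.d 1 0 ≫ g₀) ≫ E.p = 0 := by
    rw [Category.assoc, h₀]
    exact P.complex_d_comp_π_f_zero
  let g₁ : P.complex.X 1 ⟶ E.E₁ := E.exact₀.liftFromProjective (P.complex.d 1 0 ≫ g₀) k₀
  have h₁ : g₁ ≫ E.d = P.complex.d 1 0 ≫ g₀ := E.exact₀.liftFromProjective_comp _ k₀
  have k₁ : (P.complex.d 2 1 ≫ g₁) ≫ E.d = 0 := by
    rw [Category.assoc, h₁, P.complex.d_comp_d_assoc, Limits.zero_comp]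
  exact ⟨⟨g₀, g₁, E.exact₁.liftFromProjective (P.complex.d 2 1 ≫ g₁) k₁, h₀, h₁,
    E.exact₁.liftFromProjective_comp _ k₁⟩⟩

variable [Small.{v} R]

/-- The class in `Ext²(N, M)` of a `2`-extension of `N` by `M`: it is represented by the cocycle
`φ : P₂ ⟶ M` obtained by lifting the identity of `N` to a map from a projective resolution `P` of
`N` to the extension. -/
def extClass : Ext N M 2 :=
  (ProjectiveResolution.of N).extMk (E.nonempty_lift _).some.φ 3 rfl (Lift.d_comp_φ _)

end TwoExtension

/-- The `2`-extension `H_{q+1}(A) ↪ A_{q+1}/d(A_{q+2}) ⟶ ker(d : A_q ⟶ A_{q-1}) ↠ H_q(A)` of a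
chain complex `A`. -/
def homologyExtension {R : Type u} [CommRing R] (A : ChainComplex (ModuleCat.{v} R) ℤ) (q : ℤ) :
    TwoExtension (A.homology q) (A.homology (q + 1)) where
  E₁ := A.opcycles (q + 1)
  E₀ := A.cycles q
  i := A.homologyι (q + 1)
  d := A.opcyclesToCycles (q + 1) q
  p := A.homologyπ q
  i_d := A.homologyι_opcyclesToCycles (q + 1) q
  d_p := A.opcyclesToCycles_homologyπ (q + 1) q
  mono_i := inferInstance
  exact₁ := (HomologicalComplex.HomologySequence.composableArrows₃_exact A (q + 1) q
    (by simp)).exact 0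
  exact₀ := (HomologicalComplex.HomologySequence.composableArrows₃_exact A (q + 1) q
    (by simp)).exact 1
  epi_p := inferInstance

end

/-!
The cohomology of a horizontal resolution is a product of the cohomologies of the complexes
`Hom (P_{*,q}, H_{q-t})`. Since products are exact and a sign does not change kernels and images, it
is the product of the `Ext` groups (`HorizontalResolution.toExt_bijective`).

For a minimal model the relation `d_1 f_0 = f_1 d` says that `f_0` and `f_1` lift the identity of
`H_q(A)` to the homology extension, and the relation `f_2 d = d_2 f_0 + d_1 f_1` (compositions in
diagrammatic order) says that the induced cocycle is `-d_2 ρ`, which is where the sign comes from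
(`MinimalModel.homologyExtensionLift`). The class of an extension does not depend on the resolution
and on the lift (`TwoExtension.Lift.extMk_φ_eq_extClass`).

A minimal model is built by induction on the horizontal degree, on given projective resolutions
`(X_{*,q}, d_1)` of the modules `H_q(A)`. Let `T` be the sum of the columns of horizontal degree at
most `p`, with the differential and the map to `A` constructed so far. It suffices to find, for
every `x` in `X_{p+1,q}`, a cycle of `T` with leading component `d_1 x` whose image in `A` is a
boundary: since `X_{p+1,q}` is projective, these choices can be made linearly, and they are the
new components of the differential and of the map. The cycle is found by descending on the
horizontal degree of the leading component of the boundary of a candidate. That component is a cycle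
of its row, or in horizontal degree `0` it is mapped to a boundary of `A`, so that it can be removed
because the rows are exact (`HomologyRows.IsTwisted.exists_cycle`). The component of horizontal
degree `0` remains free and is used to annihilate the class in the homology of `A`
(`HomologyRows.IsTwisted.exists_extension`). The map so obtained is an `E²`-equivalence because the
rows resolve the homology.
-/

/-! ### Linear relations on projective modules -/

/-- A linear relation defined on all of a projective module contains a linear map. -/
lemma Module.Projective.exists_linearMap_of_relation {R M N : Type*} [Ring R]
    [AddCommGroup M] [Module R M] [AddCommGroup N] [Module R N] [Module.Projective R M]
    (G : Submodule R (M × N)) (hG : ∀ x, ∃ y, (x, y) ∈ G) :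
    ∃ g : M →ₗ[R] N, ∀ x, (x, g x) ∈ G := by
  obtain ⟨s, hs⟩ := Module.projective_lifting_property (LinearMap.fst R M N ∘ₗ G.subtype)
    LinearMap.id fun x => let ⟨y, hy⟩ := hG x; ⟨⟨(x, y), hy⟩, rfl⟩
  refine ⟨LinearMap.snd R M N ∘ₗ G.subtype ∘ₗ s, fun x => ?_⟩
  have h1 : (s x).1.1 = x := LinearMap.congr_fun hs x
  have h2 := (s x).2
  rw [← Prod.mk.eta (p := (s x).1), h1] at h2
  exact h2

/-! ### Resolutions of the homology, described by elements -/

/-- A projective resolution of each homology module `H_q(A)`, together with a lift `f` of the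
augmentation to cycles of `A`. Everything is expressed by elements, and the homology of `A` only
occurs through cycles and boundaries. -/
structure HomologyRows {R : Type u} [CommRing R] (A : ChainComplex (ModuleCat.{v} R) ℤ) where
  /-- the module in homological degree `p` of the resolution of `H_q(A)` -/
  X : ℕ → ℤ → ModuleCat.{v} R
  /-- the differential of the resolution -/
  d (p : ℕ) (q : ℤ) : X (p + 1) q →ₗ[R] X p q
  /-- the lift of the augmentation -/
  f (q : ℤ) : X 0 q →ₗ[R] A.X q
  projective (p : ℕ) (q : ℤ) : Projective (X p q)
  d_d (p : ℕ) (q : ℤ) (x : X (p + 2) q) : d p q (d (p + 1) q x) = 0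
  exact (p : ℕ) (q : ℤ) (x : X (p + 1) q) : d p q x = 0 → ∃ y, d (p + 1) q y = x
  d_f (q q' : ℤ) (x : X 0 q) : (A.d q q').hom (f q x) = 0
  f_d (q : ℤ) (x : X 1 q) : ∃ b, (A.d (q + 1) q).hom b = f q (d 0 q x)
  exact_zero (q : ℤ) (x : X 0 q) (b : A.X (q + 1)) :
    (A.d (q + 1) q).hom b = f q x → ∃ y, d 0 q y = x
  surj (q : ℤ) (a : A.X q) : (A.d q (q - 1)).hom a = 0 →
    ∃ x b, f q x + (A.d (q + 1) q).hom b = a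

namespace ChainComplex

variable {R : Type u} [CommRing R] (A : ChainComplex (ModuleCat.{v} R) ℤ)

/-- The differential of `A` on the product of all its modules. -/
def totalD : (∀ n, A.X n) →ₗ[R] ∀ n, A.X n :=
  LinearMap.pi fun n => (A.d (n + 1) n).hom ∘ₗ LinearMap.proj (n + 1)

lemma totalD_apply (a : ∀ n, A.X n) (m n : ℤ) (h : m = n + 1) :
    A.totalD a n = (A.d m n).hom (a m) := by
  subst h
  rfl

/-- The elements of the product of all `A_n` that are concentrated in degree `n`. -/
def homogeneous (n : ℤ) : Submodule R (∀ n, A.X n) where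
  carrier := {a | ∀ m, m ≠ n → a m = 0}
  add_mem' ha hb m hm := by simp [ha m hm, hb m hm]
  zero_mem' _ _ := rfl
  smul_mem' r a ha m hm := by simp [ha m hm]

variable {A}

lemma single_mem_homogeneous (n : ℤ) (a : A.X n) : Pi.single n a ∈ A.homogeneous n :=
  fun _ hm => Pi.single_eq_of_ne (M := fun n => A.X n) hm a

lemma eq_totalD_single {n : ℤ} {c : ∀ n, A.X n} (hc : c ∈ A.homogeneous n) {b : A.X (n + 1)}
    (hb : (A.d (n + 1) n).hom b = c n) : c = A.totalD (Pi.single (n + 1) b) := by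
  funext m
  rw [A.totalD_apply _ _ _ rfl]
  by_cases hm : m = n
  · subst hm
    rw [Pi.single_eq_same, hb]
  · rw [hc m hm, Pi.single_eq_of_ne (by lia), map_zero]

end ChainComplex

namespace HomologyRows

variable {R : Type u} [CommRing R] {A : ChainComplex (ModuleCat.{v} R) ℤ} (S : HomologyRows A)

/-! ### The filtered total module -/

/-- The direct sum of all the modules in the rows. -/
abbrev Total : Type v := Π₀ i : ℕ × ℤ, S.X i.1 i.2

/-- The inclusion of a summand. -/
abbrev ι (p : ℕ) (q : ℤ) : S.X p q →ₗ[R] S.Total :=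
  DFinsupp.lsingle (M := fun i : ℕ × ℤ => S.X i.1 i.2) (p, q)

/-- The projection to a summand. -/
abbrev proj (p : ℕ) (q : ℤ) : S.Total →ₗ[R] S.X p q :=
  DFinsupp.lapply (M := fun i : ℕ × ℤ => S.X i.1 i.2) (p, q)

/-- The elements of total degree `n` and of horizontal degree less than `k`. -/
def F (k : ℕ) (n : ℤ) : Submodule R S.Total where
  carrier := {t | ∀ p q, ¬ (p < k ∧ p + q = n) → S.proj p q t = 0}
  add_mem' ha hb p q h := by rw [map_add, ha p q h, hb p q h, add_zero]
  zero_mem' p q _ := map_zero _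
  smul_mem' r a ha p q h := by rw [map_smul, ha p q h, smul_zero]

variable {S}

lemma proj_ι_self (p : ℕ) (q : ℤ) (x : S.X p q) : S.proj p q (S.ι p q x) = x :=
  DFinsupp.single_eq_same

lemma proj_ι_of_ne {p p' : ℕ} {q q' : ℤ} (h : ¬ (p = p' ∧ q = q')) (x : S.X p q) :
    S.proj p' q' (S.ι p q x) = 0 :=
  DFinsupp.single_eq_of_ne fun e => h ⟨(congrArg Prod.fst e).symm, (congrArg Prod.snd e).symm⟩

lemma ι_mem_F {k p : ℕ} {q n : ℤ} (h : p < k) (h' : p + q = n) (x : S.X p q) :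
    S.ι p q x ∈ S.F k n := fun p' q' hp => by
  refine proj_ι_of_ne ?_ x
  rintro ⟨rfl, rfl⟩
  exact hp ⟨h, h'⟩

lemma eq_zero_of_mem_F_zero {n : ℤ} {t : S.Total} (ht : t ∈ S.F 0 n) : t = 0 :=
  DFinsupp.ext fun i => ht i.1 i.2 (by lia)

lemma F_mono {k k' : ℕ} {n : ℤ} (h : k ≤ k') : S.F k n ≤ S.F k' n :=
  fun _ ht p q hp => ht p q (by lia)

lemma mem_F_of_proj_eq_zero {k : ℕ} {q n : ℤ} {t : S.Total} (ht : t ∈ S.F (k + 1) n)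
    (hn : k + q = n) (h : S.proj k q t = 0) : t ∈ S.F k n := fun p q' hp => by
  by_cases hpk : p = k ∧ q' = q
  · obtain ⟨rfl, rfl⟩ := hpk
    exact h
  · exact ht p q' (by lia)

lemma eq_sum_of_mem_F {k : ℕ} {n : ℤ} {t : S.Total} (ht : t ∈ S.F k n) :
    t = ∑ p ∈ Finset.range k, S.ι p (n - p) (S.proj p (n - p) t) := by
  refine DFinsupp.ext fun i => ?_
  obtain ⟨p, q⟩ := i
  change S.proj p q t = S.proj p q _
  rw [map_sum]
  by_cases h : p < k ∧ p + q = n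
  · obtain rfl : q = n - p := by lia
    rw [Finset.sum_eq_single p, proj_ι_self]
    · exact fun p' _ hp => proj_ι_of_ne (by lia) _
    · exact fun hp => absurd (Finset.mem_range.2 h.1) hp
  · rw [ht p q h]
    refine (Finset.sum_eq_zero fun p' hp' => proj_ι_of_ne ?_ _).symm
    rw [Finset.mem_range] at hp'
    lia

lemma map_mem_of_mem_F {N : Type*} [AddCommGroup N] [Module R N] (L : S.Total →ₗ[R] N)
    (G : Submodule R N) {k : ℕ} {n : ℤ} {t : S.Total} (ht : t ∈ S.F k n)
    (h : ∀ (p : ℕ) (q : ℤ), p < k → p + q = n → ∀ x, L (S.ι p q x) ∈ G) : L t ∈ G := by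
  rw [eq_sum_of_mem_F ht, map_sum]
  exact G.sum_mem fun p hp => h p _ (Finset.mem_range.1 hp) (by lia) _

lemma map_eq_of_mem_F {N : Type*} [AddCommGroup N] [Module R N] (L L' : S.Total →ₗ[R] N)
    {k : ℕ} {n : ℤ} {t : S.Total} (ht : t ∈ S.F k n)
    (h : ∀ (p : ℕ) (q : ℤ), p < k → p + q = n → ∀ x, L (S.ι p q x) = L' (S.ι p q x)) :
    L t = L' t := by
  have := map_mem_of_mem_F (L - L') ⊥ ht fun p q hp hq x => by
    rw [Submodule.mem_bot, LinearMap.sub_apply, h p q hp hq x, sub_self]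
  rwa [Submodule.mem_bot, LinearMap.sub_apply, sub_eq_zero] at this

/-! ### Partial twisted structures -/

/-- The linear map out of the total module with the given restrictions to the summands. -/
def lift {N : Type*} [AddCommGroup N] [Module R N] (g : ∀ p q, S.X p q →ₗ[R] N) :
    S.Total →ₗ[R] N :=
  DFinsupp.lsum ℕ fun i : ℕ × ℤ => g i.1 i.2

lemma lift_ι {N : Type*} [AddCommGroup N] [Module R N] (g : ∀ p q, S.X p q →ₗ[R] N)
    (p : ℕ) (q : ℤ) (x : S.X p q) : lift g (S.ι p q x) = g p q x :=
  DFinsupp.lsum_single ..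

lemma lift_congr {N : Type*} [AddCommGroup N] [Module R N] {g g' : ∀ p q, S.X p q →ₗ[R] N}
    {k : ℕ} (h : ∀ p < k, g p = g' p) {n : ℤ} {t : S.Total} (ht : t ∈ S.F k n) :
    lift g t = lift g' t :=
  map_eq_of_mem_F _ _ ht fun p q hp _ x => by rw [lift_ι, lift_ι, h p hp]

/-- The maps `δ` and `φ` define a twisted complex with `d_0 = 0` and `d_1 = S.d`, and a twisted
map from it to `A` with `f_0 = S.f`, on the columns of horizontal degree less than `k`. -/
structure IsTwisted (k : ℕ) (δ : ∀ p q, S.X p q →ₗ[R] S.Total)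
    (φ : ∀ p q, S.X p q →ₗ[R] ∀ n, A.X n) : Prop where
  δ_mem : ∀ p < k, ∀ q x, δ p q x ∈ S.F p (p + q - 1)
  δ_top : ∀ p, p + 1 < k → ∀ q x, S.proj p q (δ (p + 1) q x) = S.d p q x
  φ_mem : ∀ p < k, ∀ q x, φ p q x ∈ A.homogeneous (p + q)
  φ_zero : 0 < k → ∀ q x, φ 0 q x q = S.f q x
  δ_δ : ∀ p < k, ∀ q x, lift δ (δ p q x) = 0
  φ_δ : ∀ p < k, ∀ q x, lift φ (δ p q x) = A.totalD (φ p q x)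

namespace IsTwisted

variable {δ δ' : ∀ p q, S.X p q →ₗ[R] S.Total} {φ φ' : ∀ p q, S.X p q →ₗ[R] ∀ n, A.X n} {k : ℕ}

lemma congr (h : IsTwisted k δ φ) (hδ : ∀ p < k, δ p = δ' p) (hφ : ∀ p < k, φ p = φ' p) :
    IsTwisted k δ' φ' where
  δ_mem p hp q x := by rw [← hδ p hp]; exact h.δ_mem p hp q x
  δ_top p hp q x := by rw [← hδ _ hp]; exact h.δ_top p hp q x
  φ_mem p hp q x := by rw [← hφ p hp]; exact h.φ_mem p hp q x
  φ_zero hk q x := by rw [← hφ 0 hk]; exact h.φ_zero hk q x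
  δ_δ p hp q x := by
    rw [← hδ p hp, ← lift_congr (fun p' hp' => hδ p' (hp'.trans hp)) (h.δ_mem p hp q x)]
    exact h.δ_δ p hp q x
  φ_δ p hp q x := by
    rw [← hδ p hp, ← hφ p hp,
      ← lift_congr (fun p' hp' => hφ p' (hp'.trans hp)) (h.δ_mem p hp q x)]
    exact h.φ_δ p hp q x

variable (h : IsTwisted k δ φ) {n : ℤ} {t : S.Total} (ht : t ∈ S.F k n)

include h ht

lemma lift_lift_eq_zero : lift δ (lift δ t) = 0 :=
  map_eq_of_mem_F (lift δ ∘ₗ lift δ) 0 ht fun p q hp _ x => by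
    rw [LinearMap.comp_apply, lift_ι, h.δ_δ p hp, LinearMap.zero_apply]

lemma lift_lift_eq_totalD : lift φ (lift δ t) = A.totalD (lift φ t) :=
  map_eq_of_mem_F (lift φ ∘ₗ lift δ) (A.totalD ∘ₗ lift φ) ht fun p q hp _ x => by
    rw [LinearMap.comp_apply, LinearMap.comp_apply, lift_ι, lift_ι, h.φ_δ p hp]

lemma lift_mem_homogeneous : lift φ t ∈ A.homogeneous n :=
  map_mem_of_mem_F _ _ ht fun p q hp hq x => by
    rw [lift_ι, ← hq]
    exact h.φ_mem p hp q x

omit ht in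
/-- The leading component of the differential is given by `S.d`. -/
lemma proj_lift {j : ℕ} (hj : j + 1 < k) {q : ℤ} (hn : j + 1 + q = n)
    (ht : t ∈ S.F (j + 2) n) :
    S.proj j q (lift δ t) = S.d j q (S.proj (j + 1) q t) := by
  refine map_eq_of_mem_F (S.proj j q ∘ₗ lift δ) (S.d j q ∘ₗ S.proj (j + 1) q) ht
    fun p r hp hr x => ?_
  rw [LinearMap.comp_apply, LinearMap.comp_apply, lift_ι]
  by_cases hpj : p = j + 1
  · subst hpj
    obtain rfl : r = q := by push_cast at hr; lia
    rw [h.δ_top j hj, proj_ι_self]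
  · rw [proj_ι_of_ne (by lia), map_zero]
    exact h.δ_mem p (by lia) r x j q (by lia)

omit h ht

/-- The leading component of the boundary of an element of the total module is itself a boundary
in its row, because boundaries are cycles and are mapped to boundaries of `A`. -/
lemma exists_d_eq_proj {p j : ℕ} (h : IsTwisted (p + 1) δ φ) (ht : t ∈ S.F (p + 1) n) (hj : j < p)
    {q : ℤ} (hn : j + q = n - 1) (hD : lift δ t ∈ S.F (j + 1) (n - 1)) :
    ∃ y, S.d j q y = S.proj j q (lift δ t) := by
  rcases j with _ | j
  · obtain rfl : q = n - 1 := by push_cast at hn; lia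
    refine S.exact_zero _ _ (lift φ t (n - 1 + 1)) ?_
    rw [← A.totalD_apply _ _ _ rfl, ← h.lift_lift_eq_totalD ht, ← h.φ_zero (by lia), ← lift_ι φ]
    refine congrFun (congrArg (lift φ) ?_) _
    have := eq_sum_of_mem_F hD
    rw [Finset.sum_range_one] at this
    have e : n - 1 - ((0 : ℕ) : ℤ) = n - 1 := by simp
    rwa [e] at this
  · refine S.exact _ _ _ ?_
    rw [← h.proj_lift (by lia) (by push_cast at hn; exact hn) hD, h.lift_lift_eq_zero ht, map_zero]

/-- Below the leading component, an element of the total module can be modified to a cycle. -/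
lemma exists_cycle {p : ℕ} (h : IsTwisted (p + 1) δ φ) (j : ℕ) (hj : j < p)
    (t : S.Total) (ht : t ∈ S.F (p + 1) n) (hD : lift δ t ∈ S.F j (n - 1)) :
    ∃ t' ∈ S.F (p + 1) n, lift δ t' = 0 ∧ ∀ q, S.proj p q t' = S.proj p q t := by
  induction j generalizing t with
  | zero => exact ⟨t, ht, eq_zero_of_mem_F_zero hD, fun q => rfl⟩
  | succ j ih =>
    obtain ⟨q, hq⟩ : ∃ q : ℤ, j + q = n - 1 := ⟨n - 1 - j, by ring⟩
    obtain ⟨y, hy⟩ := h.exists_d_eq_proj ht (by lia) hq hD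
    obtain ⟨t', ht', h1, h2⟩ := ih (by lia) (t - S.ι (j + 1) q y)
      (Submodule.sub_mem _ ht (ι_mem_F (by lia) (by push_cast; lia) y)) (by
        have e : ((j + 1 : ℕ) : ℤ) + q - 1 = n - 1 := by push_cast; lia
        refine mem_F_of_proj_eq_zero (q := q) ?_ hq ?_
        · rw [map_sub, lift_ι, ← e]
          exact Submodule.sub_mem _ (e ▸ hD) (h.δ_mem _ (by lia) q y)
        · rw [map_sub, map_sub, lift_ι, h.δ_top j (by lia), hy, sub_self])
    refine ⟨t', ht', h1, fun q' => ?_⟩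
    rw [h2 q', map_sub, proj_ι_of_ne (by lia), sub_zero]

/-- Every boundary `d_1 x` in a row is the leading component of a cycle of the total module, which
is moreover mapped to a boundary of `A`. The component in horizontal degree `0` of the cycle is
corrected so that its image in the homology of `A` vanishes. -/
lemma exists_extension {p : ℕ} (h : IsTwisted (p + 1) δ φ) (q : ℤ) (x : S.X (p + 1) q) :
    ∃ t ∈ S.F (p + 1) (p + q), ∃ a ∈ A.homogeneous (p + q + 1),
      S.proj p q t = S.d p q x ∧ lift δ t = 0 ∧ lift φ t = A.totalD a := by
  rcases p with _ | p
  · have hm := ι_mem_F (n := (0 : ℕ) + q) zero_lt_one rfl (S.d 0 q x)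
    obtain ⟨b, hb⟩ := S.f_d q x
    have e : ((0 : ℕ) : ℤ) + q = q := by simp
    have hh := h.lift_mem_homogeneous hm
    rw [e] at hh
    refine ⟨S.ι 0 q (S.d 0 q x), hm, Pi.single (q + 1) b, ?_, proj_ι_self _ _ _, ?_, ?_⟩
    · rw [e]
      exact ChainComplex.single_mem_homogeneous _ _
    · rw [lift_ι]
      exact eq_zero_of_mem_F_zero (h.δ_mem 0 zero_lt_one q _)
    · refine ChainComplex.eq_totalD_single hh ?_
      rw [hb, lift_ι, h.φ_zero zero_lt_one]
  · obtain ⟨n, hn⟩ : ∃ n : ℤ, n = (p + 1 : ℕ) + q := ⟨_, rfl⟩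
    have hm : S.ι (p + 1) q (S.d (p + 1) q x) ∈ S.F (p + 2) n :=
      ι_mem_F (by lia) hn.symm _
    obtain ⟨t, ht, h1, h2⟩ := h.exists_cycle p (by lia) _ hm (by
      refine mem_F_of_proj_eq_zero (q := q) ?_ (by push_cast at hn; lia) ?_
      · rw [lift_ι, hn]
        exact h.δ_mem _ (by lia) q _
      · rw [lift_ι, h.δ_top p (by lia), S.d_d])
    have hc : (A.d n (n - 1)).hom (lift φ t n) = 0 := by
      rw [← A.totalD_apply _ _ _ (by ring), ← h.lift_lift_eq_totalD ht, h1, map_zero]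
      rfl
    -- `z` represents the homology class of the image of `t`, which vanishes once `z` is subtracted
    obtain ⟨z, b, hzb⟩ := S.surj n _ hc
    have hz : S.ι 0 n z ∈ S.F (p + 2) n := ι_mem_F (by lia) (by simp) z
    rw [← hn]
    refine ⟨t - S.ι 0 n z, Submodule.sub_mem _ ht hz, Pi.single (n + 1) b,
      ChainComplex.single_mem_homogeneous _ _, ?_, ?_, ?_⟩
    · rw [map_sub, h2, proj_ι_self, proj_ι_of_ne (by lia), sub_zero]
    · rw [map_sub, h1, lift_ι, zero_sub, neg_eq_zero]
      exact eq_zero_of_mem_F_zero (h.δ_mem 0 (by lia) n z)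
    · refine ChainComplex.eq_totalD_single
        (h.lift_mem_homogeneous (Submodule.sub_mem _ ht hz)) ?_
      rw [map_sub, lift_ι, Pi.sub_apply, h.φ_zero (by lia), ← hzb, add_sub_cancel_left]

end IsTwisted

/-- The induction step: the next column is obtained from the extension property of elements, since
its modules are projective. -/
lemma IsTwisted.exists_succ [Small.{v} R] {k : ℕ} {δ : ∀ p q, S.X p q →ₗ[R] S.Total}
    {φ : ∀ p q, S.X p q →ₗ[R] ∀ n, A.X n} (h : IsTwisted (k + 1) δ φ) :
    ∃ δ' φ', IsTwisted (S := S) (k + 2) δ' φ' ∧ ∀ p < k + 1, δ p = δ' p ∧ φ p = φ' p := by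
  have hL : ∀ q, ∃ g : S.X (k + 1) q →ₗ[R] S.Total × ∀ n, A.X n, ∀ x,
      (g x).1 ∈ S.F (k + 1) (k + q) ∧ (g x).2 ∈ A.homogeneous (k + q + 1) ∧
      S.proj k q (g x).1 = S.d k q x ∧ lift δ (g x).1 = 0 ∧
      lift φ (g x).1 = A.totalD (g x).2 := by
    intro q
    have := S.projective (k + 1) q
    have : Module.Projective R (S.X (k + 1) q) := (IsProjective.iff_projective _).2 this
    let G : Submodule R (S.X (k + 1) q × (S.Total × ∀ n, A.X n)) :=
      { carrier := {w | w.2.1 ∈ S.F (k + 1) (k + q) ∧ w.2.2 ∈ A.homogeneous (k + q + 1) ∧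
          S.proj k q w.2.1 = S.d k q w.1 ∧ lift δ w.2.1 = 0 ∧ lift φ w.2.1 = A.totalD w.2.2}
        add_mem' := by
          rintro a b ⟨a1, a2, a3, a4, a5⟩ ⟨b1, b2, b3, b4, b5⟩
          exact ⟨Submodule.add_mem _ a1 b1, Submodule.add_mem _ a2 b2,
            by simp only [Prod.snd_add, Prod.fst_add, map_add, a3, b3],
            by simp only [Prod.snd_add, Prod.fst_add, map_add, a4, b4, add_zero],
            by simp only [Prod.snd_add, Prod.fst_add, map_add, a5, b5]⟩
        zero_mem' := ⟨Submodule.zero_mem _, Submodule.zero_mem _,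
          by simp only [Prod.snd_zero, Prod.fst_zero, map_zero],
          by simp only [Prod.snd_zero, Prod.fst_zero, map_zero],
          by simp only [Prod.snd_zero, Prod.fst_zero, map_zero]⟩
        smul_mem' := by
          rintro r a ⟨a1, a2, a3, a4, a5⟩
          exact ⟨Submodule.smul_mem _ r a1, Submodule.smul_mem _ r a2,
            by simp only [Prod.smul_snd, Prod.smul_fst, map_smul, a3],
            by simp only [Prod.smul_snd, Prod.smul_fst, map_smul, a4, smul_zero],
            by simp only [Prod.smul_snd, Prod.smul_fst, map_smul, a5]⟩ }
    refine Module.Projective.exists_linearMap_of_relation G fun x => ?_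
    obtain ⟨t, ht, a, ha, h1, h2, h3⟩ := h.exists_extension q x
    exact ⟨(t, a), ht, ha, h1, h2, h3⟩
  choose g h1 h2 h3 h4 h5 using hL
  let δ' := Function.update δ (k + 1) fun q => LinearMap.fst R _ _ ∘ₗ g q
  let φ' := Function.update φ (k + 1) fun q => LinearMap.snd R _ _ ∘ₗ g q
  have eδ (q) (x) : δ' (k + 1) q x = (g q x).1 := by
    rw [show δ' (k + 1) = _ from Function.update_self ..]
    rfl
  have eφ (q) (x) : φ' (k + 1) q x = (g q x).2 := by
    rw [show φ' (k + 1) = _ from Function.update_self ..]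
    rfl
  have hδ : ∀ p < k + 1, δ p = δ' p := fun p hp => (Function.update_of_ne hp.ne _ _).symm
  have hφ : ∀ p < k + 1, φ p = φ' p := fun p hp => (Function.update_of_ne hp.ne _ _).symm
  have h' : IsTwisted (k + 1) δ' φ' := h.congr hδ hφ
  have e (q : ℤ) : ((k + 1 : ℕ) : ℤ) + q - 1 = k + q := by push_cast; ring
  have e' (q : ℤ) : ((k + 1 : ℕ) : ℤ) + q = k + q + 1 := by push_cast; ring
  refine ⟨δ', φ', ⟨?_, ?_, ?_, fun _ => h'.φ_zero (by lia), ?_, ?_⟩,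
    fun p hp => ⟨hδ p hp, hφ p hp⟩⟩
  all_goals
    intro p hp q x
  · rcases Nat.lt_succ_iff_lt_or_eq.1 hp with hp | rfl
    · exact h'.δ_mem p hp q x
    · rw [eδ, e]
      exact h1 q x
  · rcases Nat.lt_succ_iff_lt_or_eq.1 (Nat.lt_of_succ_lt_succ hp) with hp | rfl
    · exact h'.δ_top p (by lia) q x
    · rw [eδ]
      exact h3 q x
  · rcases Nat.lt_succ_iff_lt_or_eq.1 hp with hp | rfl
    · exact h'.φ_mem p hp q x
    · rw [eφ, e']
      exact h2 q x
  · rcases Nat.lt_succ_iff_lt_or_eq.1 hp with hp | rfl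
    · exact h'.δ_δ p hp q x
    · rw [eδ, ← lift_congr hδ (h1 q x)]
      exact h4 q x
  · rcases Nat.lt_succ_iff_lt_or_eq.1 hp with hp | rfl
    · exact h'.φ_δ p hp q x
    · rw [eδ, eφ, ← lift_congr hφ (h1 q x)]
      exact h5 q x

variable (S)

lemma exists_isTwisted_one : ∃ δ φ, IsTwisted (S := S) 1 δ φ := by
  -- only the column of horizontal degree `0` matters here, and its differential vanishes
  let φ : ∀ p q, S.X p q →ₗ[R] ∀ n, A.X n := fun
    | 0, q => LinearMap.single R (fun n => A.X n) q ∘ₗ S.f q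
    | _ + 1, _ => 0
  have hφ (q) (x) : φ 0 q x = Pi.single q (S.f q x) := rfl
  refine ⟨0, φ, ⟨fun _ _ _ _ => Submodule.zero_mem _, by lia, ?_, ?_, ?_, ?_⟩⟩
  · intro p hp q x
    obtain rfl : p = 0 := by lia
    have e : ((0 : ℕ) : ℤ) + q = q := by simp
    rw [e, hφ]
    exact ChainComplex.single_mem_homogeneous _ _
  · intro _ q x
    rw [hφ, Pi.single_eq_same]
  · exact fun p hp q x => map_zero _
  · intro p hp q x
    obtain rfl : p = 0 := by lia
    refine (map_zero _).trans (funext fun n => Eq.symm ?_)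
    rw [hφ, A.totalD_apply _ _ _ rfl]
    by_cases hn : n + 1 = q
    · subst hn
      rw [Pi.single_eq_same, S.d_f]
      rfl
    · rw [Pi.single_eq_of_ne hn, map_zero]
      rfl

/-- The partial structures on more and more columns agree on their common columns, so that they
assemble to a structure on all columns. -/
lemma exists_isTwisted [Small.{v} R] : ∃ δ φ, ∀ k, IsTwisted (S := S) k δ φ := by
  let Stage (k : ℕ) := {w : (∀ p q, S.X p q →ₗ[R] S.Total) ×
    (∀ p q, S.X p q →ₗ[R] ∀ n, A.X n) // IsTwisted (k + 1) w.1 w.2}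
  have hsucc : ∀ k (w : Stage k), ∃ w' : Stage (k + 1),
      ∀ p < k + 1, w.1.1 p = w'.1.1 p ∧ w.1.2 p = w'.1.2 p := fun k w => by
    obtain ⟨δ', φ', h, h'⟩ := w.2.exists_succ
    exact ⟨⟨(δ', φ'), h⟩, h'⟩
  choose next hnext using hsucc
  obtain ⟨δ₀, φ₀, h₀⟩ := S.exists_isTwisted_one
  let w : ∀ k, Stage k := fun k => Nat.rec ⟨(δ₀, φ₀), h₀⟩ next k
  have hw (p k : ℕ) (h : p ≤ k) :
      (w k).1.1 p = (w p).1.1 p ∧ (w k).1.2 p = (w p).1.2 p := by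
    induction k, h using Nat.le_induction with
    | base => exact ⟨rfl, rfl⟩
    | succ k hk ih =>
      have := hnext k (w k) p (by lia)
      exact ⟨this.1.symm.trans ih.1, this.2.symm.trans ih.2⟩
  -- the column `p` is constructed in stage `p` and is not changed afterwards
  refine ⟨fun p => (w p).1.1 p, fun p => (w p).1.2 p, fun k => ?_⟩
  have h : IsTwisted (k + 1) (fun p => (w p).1.1 p) (fun p => (w p).1.2 p) :=
    (w k).2.congr (fun p hp => (hw p k (by lia)).1) fun p hp => (hw p k (by lia)).2
  exact ⟨fun p hp => h.δ_mem p (by lia), fun p hp => h.δ_top p (by lia),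
    fun p hp => h.φ_mem p (by lia), fun hk => h.φ_zero (by lia),
    fun p hp => h.δ_δ p (by lia), fun p hp => h.φ_δ p (by lia)⟩

/-! ### The minimal model of a chain complex -/

variable {S} {δ : ∀ p q, S.X p q →ₗ[R] S.Total} {φ : ∀ p q, S.X p q →ₗ[R] ∀ n, A.X n}

/-- The twisted complex whose differential is given by `δ` on all columns. -/
def twistedComplex (h : ∀ k, IsTwisted k δ φ) : TwistedComplex.{v} R where
  X := S.X
  d p q p' q' := ModuleCat.ofHom (S.proj p' q' ∘ₗ δ p q)
  shape p q p' q' hp := by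
    ext x
    exact (h (p + 1)).δ_mem p (by lia) q x p' q' (by lia)
  d_comp_d p q p' q' hp := by
    ext x
    have h1 := (h (p + 1)).δ_δ p (by lia) q x
    rw [eq_sum_of_mem_F (F_mono p.le_succ ((h (p + 1)).δ_mem p (by lia) q x)), map_sum] at h1
    have h2 := congrArg (S.proj p' q') h1
    rw [map_sum, map_zero] at h2
    rw [ModuleCat.hom_sum, LinearMap.sum_apply]
    refine Eq.trans (Finset.sum_congr rfl fun k _ => ?_) h2
    rw [lift_ι]
    rfl

/-- The twisted map to `A` given by `φ`. -/
def twistedMap (h : ∀ k, IsTwisted k δ φ) :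
    TwistedMap (twistedComplex h) (TwistedComplex.ofComplex A) where
  f
    | p, q, 0, q' => ModuleCat.ofHom (LinearMap.proj q' ∘ₗ φ p q)
    | _, _, _ + 1, _ => 0
  shape := by
    rintro p q (_ | p') q' hp
    · ext x
      exact (h (p + 1)).φ_mem p (by lia) q x q' (by push_cast at hp; lia)
    · rfl
  comm := by
    rintro p q (_ | p') q' hp
    · rw [Finset.sum_eq_single 0]
      · ext x
        have h1 := (h (p + 1)).φ_δ p (by lia) q x
        rw [eq_sum_of_mem_F (F_mono p.le_succ ((h (p + 1)).δ_mem p (by lia) q x)), map_sum] at h1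
        have h2 := congrFun h1 q'
        rw [A.totalD_apply _ _ _ (show (p : ℤ) + q - (0 : ℕ) = q' + 1 by push_cast at hp ⊢; lia),
          Finset.sum_apply] at h2
        rw [ModuleCat.hom_sum, LinearMap.sum_apply]
        refine h2.symm.trans (Finset.sum_congr rfl fun k _ => ?_)
        rw [lift_ι]
        rfl
      · rintro (_ | k) _ hk
        · exact absurd rfl hk
        · exact Limits.comp_zero
      · simp
    · ext x
      exact Subsingleton.elim (α := PUnit) _ _

lemma isE2Equivalence_twistedMap (h : ∀ k, IsTwisted k δ φ) :
    (twistedMap h).IsE2Equivalence := by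
  have hd0 (p : ℕ) (q q' : ℤ) : (twistedComplex h).d p q p q' = 0 := by
    ext x
    exact (h (p + 1)).δ_mem p (by lia) q x p q' (by lia)
  have hd1 (p : ℕ) (q : ℤ) (x : S.X (p + 1) q) :
      ((twistedComplex h).d (p + 1) q p q).hom x = S.d p q x :=
    (h (p + 2)).δ_top p (by lia) q x
  have hB (p : ℕ) (q : ℤ) (x : (twistedComplex h).X p q) :
      x ∈ (twistedComplex h).B2 p q ↔ ∃ y, S.d p q y = x := by
    simp only [TwistedComplex.B2, hd0]
    rw [ModuleCat.hom_zero, ModuleCat.hom_zero, LinearMap.range_zero, bot_sup_eq,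
      LinearMap.ker_zero, Submodule.map_top, LinearMap.mem_range]
    exact exists_congr fun y => Eq.congr_left (hd1 p q y)
  have hf (q : ℤ) (x : S.X 0 q) : ((twistedMap h).f 0 q 0 q).hom x = S.f q x :=
    (h 1).φ_zero zero_lt_one q x
  rintro (_ | p) q
  · constructor
    · rw [injective_iff_map_eq_zero]
      intro z hz
      obtain ⟨⟨x, hx⟩, rfl⟩ := Submodule.Quotient.mk_surjective _ z
      have h1 := (Submodule.Quotient.mk_eq_zero _).1 hz
      obtain ⟨b, hb⟩ := (MinimalModel.ofComplex_B2_zero q _).1 h1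
      exact (Submodule.Quotient.mk_eq_zero _).2
        ((hB 0 q x).2 (S.exact_zero q x b (hb.trans (hf q x))))
    · intro z
      obtain ⟨⟨a, ha⟩, rfl⟩ := Submodule.Quotient.mk_surjective _ z
      obtain ⟨x, b, hxb⟩ := S.surj q a ((MinimalModel.ofComplex_Z2_zero q a).1 ha)
      refine ⟨Submodule.Quotient.mk ⟨x, ?_⟩, (Submodule.Quotient.eq _).2
        ((MinimalModel.ofComplex_B2_zero q _).2 ⟨-b, ?_⟩)⟩
      · simp only [TwistedComplex.Z2, hd0, ModuleCat.hom_zero, LinearMap.ker_zero, top_inf_eq]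
        exact (Submodule.mem_iInf _).2 fun p' => (Submodule.mem_iInf _).2 fun hp' =>
          absurd hp' p'.succ_ne_zero
      · have h1 : (A.d (q + 1) q).hom (-b) = S.f q x - (S.f q x + (A.d (q + 1) q).hom b) := by
          rw [map_neg, sub_add_cancel_left]
        exact h1.trans (congrArg₂ (fun s t : A.X q => s - t) (hf q x).symm hxb)
  · constructor
    · rw [injective_iff_map_eq_zero]
      intro z _
      obtain ⟨⟨x, hx⟩, rfl⟩ := Submodule.Quotient.mk_surjective _ z
      have h1 := (Submodule.mem_iInf _).1 ((Submodule.mem_iInf _).1 hx.2 p) rfl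
      rw [hd0] at h1
      obtain ⟨_, h1⟩ := h1
      exact (Submodule.Quotient.mk_eq_zero _).2
        ((hB (p + 1) q x).2 (S.exact p q x ((hd1 p q x).symm.trans h1.symm)))
    · intro z
      obtain ⟨⟨a, ha⟩, rfl⟩ := Submodule.Quotient.mk_surjective _ z
      refine ⟨0, (map_zero _).trans (Eq.symm ((Submodule.Quotient.mk_eq_zero _).2 ?_))⟩
      have : a = 0 := Subsingleton.elim (α := PUnit) _ _
      subst this
      exact Submodule.zero_mem _

/-- The minimal model given by a structure on all columns. -/
def minimalModel (h : ∀ k, IsTwisted k δ φ) : MinimalModel A where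
  model := twistedComplex h
  minimal p q q' := by
    ext x
    exact (h (p + 1)).δ_mem p (by lia) q x p q' (by lia)
  projective := S.projective
  map := twistedMap h
  isE2Equivalence := isE2Equivalence_twistedMap h

variable (A) in
lemma nonempty_homologyRows [Small.{v} R] : Nonempty (HomologyRows A) := by
  let P q := ProjectiveResolution.of (A.homology q)
  let π q : (P q).complex.X 0 ⟶ A.homology q := (P q).π.f 0
  have hπ q : Epi (π q) := inferInstanceAs (Epi ((P q).π.f 0))
  let g q : (P q).complex.X 0 ⟶ A.cycles q := Projective.factorThru (π q) (A.homologyπ q)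
  have hg q : g q ≫ A.homologyπ q = π q := Projective.factorThru_comp _ _
  have hex q := (ShortComplex.moduleCat_exact_iff _).1
    (ShortComplex.exact_of_g_is_cokernel
      (ShortComplex.mk _ _ (A.toCycles_comp_homologyπ (q + 1) q))
      (A.homologyIsCokernel (q + 1) q (by simp)))
  have hd (q) (b : A.X (q + 1)) (z : A.cycles q) :
      (A.d (q + 1) q).hom b = (A.iCycles q).hom z ↔ (A.toCycles (q + 1) q).hom b = z := by
    rw [← A.toCycles_i]
    exact ((ModuleCat.mono_iff_injective (A.iCycles q)).1 inferInstance).eq_iff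
  refine ⟨{
    X := fun p q => (P q).complex.X p
    d := fun p q => ((P q).complex.d (p + 1) p).hom
    f := fun q => (g q ≫ A.iCycles q).hom
    projective := fun p q => (P q).projective p
    d_d := fun p q x => ?_
    exact := fun p q => (ShortComplex.moduleCat_exact_iff _).1 ((P q).exact_succ p)
    d_f := fun q q' x => ?_
    f_d := fun q x => ?_
    exact_zero := fun q x b hb => ?_
    surj := fun q a ha => ?_ }⟩
  · exact congrArg (fun u => u.hom x) ((P q).complex.d_comp_d (p + 2) (p + 1) p)
  · have : (g q ≫ A.iCycles q) ≫ A.d q q' = 0 := by simp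
    exact congrArg (fun u => u.hom x) this
  · obtain ⟨b, hb⟩ := hex q ((g q).hom (((P q).complex.d 1 0).hom x)) (by
      have : (P q).complex.d 1 0 ≫ g q ≫ A.homologyπ q = 0 := by
        rw [hg]
        exact (P q).complex_d_comp_π_f_zero
      exact congrArg (fun u => u.hom x) this)
    exact ⟨b, (hd q b _).2 hb⟩
  · refine (ShortComplex.moduleCat_exact_iff _).1 (P q).exact₀ x ?_
    refine (congrArg (fun u => u.hom x) (hg q).symm).trans ?_
    have h1 := (hd q b ((g q).hom x)).1 hb
    change (A.homologyπ q).hom ((g q).hom x) = 0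
    rw [← h1]
    exact congrArg (fun u => u.hom b) (A.toCycles_comp_homologyπ (q + 1) q)
  · obtain ⟨z, hz⟩ := (ShortComplex.moduleCat_exact_iff _).1
      (ShortComplex.exact_of_f_is_kernel (ShortComplex.mk _ _ (A.iCycles_d q (q - 1)))
        (A.cyclesIsKernel q (q - 1) (by simp))) a ha
    obtain ⟨x, hx⟩ := (ModuleCat.epi_iff_surjective (π q)).1 (hπ q) ((A.homologyπ q).hom z)
    obtain ⟨b, hb⟩ := hex q (z - (g q).hom x) (by
      change (A.homologyπ q).hom _ = 0
      rw [map_sub, ← hx, ← hg]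
      exact sub_self _)
    refine ⟨x, b, ?_⟩
    rw [(hd q b _).2 hb, map_sub]
    exact (add_sub_cancel _ _).trans hz

end HomologyRows

lemma MinimalModel.nonempty {R : Type u} [CommRing R] [Small.{v} R]
    (A : ChainComplex (ModuleCat.{v} R) ℤ) : Nonempty (MinimalModel A) := by
  obtain ⟨S⟩ := HomologyRows.nonempty_homologyRows A
  obtain ⟨δ, φ, h⟩ := S.exists_isTwisted
  exact ⟨HomologyRows.minimalModel h⟩

/-! ### Algebras over the initial operad -/

/-- The unit of the initial operad acts by the identity, so that a scalar `r` acts by `r`. -/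
lemma InitialOperadAlgebra.act_apply {R : Type u} [CommRing R] (A : InitialOperadAlgebra.{v} R)
    (r : R) : A.act r = r • 𝟙 A.complex :=
  (A.act.commutes r).trans (Algebra.algebraMap_eq_smul_one r)

instance InitialOperadAlgebra.forget_isEquivalence {R : Type u} [CommRing R] :
    (InitialOperadAlgebra.forget.{v} R).IsEquivalence where
  faithful := ⟨fun h => InitialOperadAlgebra.Hom.ext h⟩
  full := ⟨fun {A B} (g : A.complex ⟶ B.complex) => ⟨⟨g, fun r => by
    rw [InitialOperadAlgebra.act_apply, InitialOperadAlgebra.act_apply]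
    rw [Linear.smul_comp, Linear.comp_smul, Category.id_comp, Category.comp_id]⟩, rfl⟩⟩
  essSurj := ⟨fun A => ⟨⟨A, Algebra.ofId R _⟩, ⟨Iso.refl _⟩⟩⟩

/-! ### Cohomology of a horizontal resolution and `Ext` -/

/-- A cocycle of the operadic cochain complex of positive horizontal degree is a coboundary as
soon as its components represent zero, and a family of classes is represented componentwise. -/
lemma HorizontalResolution.toExt_bijective {R : Type u} [CommRing R] [Small.{v} R]
    {H : ℤ → ModuleCat.{v} R} (P : HorizontalResolution H) (M : ℤ → ModuleCat.{v} R)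
    (w : ℕ) (t : ℤ) : Function.Bijective (P.toExt M (w + 1) t) := by
  constructor
  · rw [← LinearMap.ker_eq_bot, toExt, Submodule.ker_liftQ_eq_bot']
    refine le_antisymm (P.coboundaries_le_ker M (w + 1) t) ?_
    rintro ⟨ψ, hψ⟩ h
    have h0 : ∀ j, ∃ g : (P j.1.1).complex.X w ⟶ M j.1.2,
        (P j.1.1).complex.d (w + 1) w ≫ g = ψ j := fun j =>
      ((P j.1.1).extMk_eq_zero_iff (ψ j) (w + 2) rfl (d_comp_eq_zero hψ j) w rfl).1
        (congrFun (LinearMap.mem_ker.1 h) j)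
    choose g hg using h0
    refine ⟨fun j => (-1 : R) ^ (w + 1) • g j, ?_⟩
    funext j
    change (-1 : R) ^ (w + 1) • ((P j.1.1).complex.d (w + 1) w ≫ ((-1 : R) ^ (w + 1) • g j)) = ψ j
    rw [Linear.comp_smul, smul_smul, ← mul_pow, hg]
    simp
  · intro α
    choose ψ hψ hα using fun j => (P j.1.1).extMk_surjective (α j) (w + 2) rfl
    refine ⟨Submodule.Quotient.mk ⟨ψ, ?_⟩, funext hα⟩
    refine LinearMap.mem_ker.2 (funext fun j => ?_)
    change (-1 : R) ^ (w + 1 + 1) • ((P j.1.1).complex.d (w + 1 + 1) (w + 1) ≫ ψ j) = 0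
    rw [hψ, smul_zero]

/-! ### Classes of `2`-extensions -/

namespace TwoExtension

variable {R : Type u} [CommRing R] {N M : ModuleCat.{v} R} {E : TwoExtension N M}

/-- Two lifts of the identity on the same resolution are homotopic, so that their cocycles differ
by a coboundary. -/
lemma Lift.exists_sub_eq {P : ProjectiveResolution N} (l l' : E.Lift P) :
    ∃ h : P.complex.X 1 ⟶ M, P.complex.d 2 1 ≫ h = l.φ - l'.φ := by
  have := E.mono_i
  have k₀ : (l.g₀ - l'.g₀) ≫ E.p = 0 := by
    rw [Preadditive.sub_comp]
    exact sub_eq_zero.2 (l.comm₀.trans l'.comm₀.symm)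
  let h₀ : P.complex.X 0 ⟶ E.E₁ := E.exact₀.liftFromProjective _ k₀
  have e₀ : h₀ ≫ E.d = l.g₀ - l'.g₀ := E.exact₀.liftFromProjective_comp _ k₀
  have k₁ : (l.g₁ - l'.g₁ - P.complex.d 1 0 ≫ h₀) ≫ E.d = 0 := by
    rw [Preadditive.sub_comp, Preadditive.sub_comp, l.comm₁, l'.comm₁, Category.assoc, e₀,
      Preadditive.comp_sub, sub_self]
  refine ⟨E.exact₁.liftFromProjective _ k₁, ?_⟩
  rw [← cancel_mono E.i, Category.assoc]
  refine (congrArg (P.complex.d 2 1 ≫ ·) (E.exact₁.liftFromProjective_comp _ k₁)).trans ?_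
  simp [l.comm₂, l'.comm₂]

/-- A lift on one resolution, precomposed with a comparison of resolutions. -/
def Lift.precomp {P P' : ProjectiveResolution N} (l : E.Lift P)
    (c : ProjectiveResolution.Hom P' P (𝟙 N)) : E.Lift P' where
  g₀ := c.hom.f 0 ≫ l.g₀
  g₁ := c.hom.f 1 ≫ l.g₁
  φ := c.hom.f 2 ≫ l.φ
  comm₀ := by
    rw [Category.assoc, l.comm₀]
    refine c.hom_f_zero_comp_π_f_zero.trans ?_
    rw [CategoryTheory.Functor.map_id, HomologicalComplex.id_f]
    exact Category.comp_id _
  comm₁ := by rw [Category.assoc, l.comm₁, c.hom.comm_assoc]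
  comm₂ := by rw [Category.assoc, l.comm₂, c.hom.comm_assoc]

lemma Lift.extMk_φ_eq_extClass [Small.{v} R] {P : ProjectiveResolution N} (l : E.Lift P) :
    P.extMk l.φ 3 rfl l.d_comp_φ = E.extClass := by
  let l₀ := (E.nonempty_lift (ProjectiveResolution.of N)).some
  let c : ProjectiveResolution.Hom P (ProjectiveResolution.of N) (𝟙 N) :=
    ⟨ProjectiveResolution.lift (𝟙 N) _ _, by
      rw [ProjectiveResolution.lift_commutes_zero]
      refine (Category.comp_id _).trans (Eq.symm ?_)
      rw [CategoryTheory.Functor.map_id, HomologicalComplex.id_f]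
      exact Category.comp_id _⟩
  have h := ProjectiveResolution.mk₀_comp_extMk l₀.φ 3 rfl l₀.d_comp_φ c
  rw [Ext.mk₀_id_comp] at h
  refine Eq.trans ?_ h.symm
  rw [← sub_eq_zero, ProjectiveResolution.sub_extMk,
    ProjectiveResolution.extMk_eq_zero_iff _ _ _ _ _ 1 rfl]
  exact l.exists_sub_eq (l₀.precomp c)

end TwoExtension

/-! ### The universal Massey product -/

namespace MinimalModel

variable {R : Type u} [CommRing R] {A : ChainComplex (ModuleCat.{v} R) ℤ} (m : MinimalModel A)

/-- The piece `f_2` in horizontal degree `2`. -/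
def f₂ (q : ℤ) : m.model.X 2 q ⟶ A.X (q + 2) := m.map.f 2 q 0 (q + 2)

/-- The relation `d f_2 = d_2 f_0 + d_1 f_1` (in diagrammatic order) on `X_{2,q}`. -/
lemma f_two_comp_d (q : ℤ) :
    m.f₂ q ≫ A.d (q + 2) (q + 1) =
      m.model.d 2 q 0 (q + 1) ≫ m.f₀ (q + 1) + m.model.d 2 q 1 q ≫ m.f₁ q := by
  have h := m.map.comm 2 q 0 (q + 1) (by push_cast; lia)
  rw [Finset.sum_range_succ, Finset.sum_range_succ, Finset.sum_range_one,
    Finset.sum_range_succ, Finset.sum_range_succ, Finset.sum_range_one] at h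
  have e0 : ((2 : ℕ) : ℤ) + q - (0 : ℕ) = q + 2 := by push_cast; ring
  have e1 : ((2 : ℕ) : ℤ) + q - 1 - (0 : ℕ) = q + 1 := by push_cast; ring
  have e2 : ((2 : ℕ) : ℤ) + q - 1 - (1 : ℕ) = q := by push_cast; ring
  have z1 : (TwistedComplex.ofComplex A).d 1 (((2 : ℕ) : ℤ) + q - (1 : ℕ)) 0 (q + 1) = 0 := rfl
  have z2 : (TwistedComplex.ofComplex A).d 2 (((2 : ℕ) : ℤ) + q - (2 : ℕ)) 0 (q + 1) = 0 := rfl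
  rw [z1, z2, m.minimal 2, e0, e1, e2, Limits.comp_zero, Limits.comp_zero, Limits.zero_comp,
    add_zero, add_zero, add_zero] at h
  exact h

/-- The components `f_0` and `f_1` of a minimal model lift the identity of `H_q(A)` to the
homology extension. By the relation for `f_2` the induced cocycle is `-ρ d_2`. -/
noncomputable def homologyExtensionLift (q : ℤ) :
    (homologyExtension A q).Lift (m.horizontalResolution q) where
  g₀ := A.liftCycles (m.f₀ q) (q - 1) (by simp) (m.f₀_comp_d q (q - 1))
  g₁ := m.f₁ q ≫ A.pOpcycles (q + 1)
  φ := (-(m.model.d 2 q 0 (q + 1) ≫ m.ρ (q + 1)) : m.model.X 2 q ⟶ A.homology (q + 1))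
  comm₀ := (m.rowπ_f_zero q).symm
  comm₁ := by
    refine Eq.trans ?_ (congrArg
      (· ≫ A.liftCycles (m.f₀ q) (q - 1) (by simp) (m.f₀_comp_d q (q - 1))) (m.row_d 0 q).symm)
    refine (cancel_mono (A.iCycles q)).1 ?_
    change ((m.f₁ q ≫ A.pOpcycles (q + 1)) ≫ A.opcyclesToCycles (q + 1) q) ≫ A.iCycles q =
      (m.model.d 1 q 0 q ≫
        A.liftCycles (m.f₀ q) (q - 1) (by simp) (m.f₀_comp_d q (q - 1))) ≫ A.iCycles q
    simp only [Category.assoc, HomologicalComplex.liftCycles_i,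
      HomologicalComplex.opcyclesToCycles_iCycles, HomologicalComplex.p_fromOpcycles]
    exact m.f₁_comp_d q
  comm₂ := by
    refine Eq.trans ?_ (congrArg (· ≫ (m.f₁ q ≫ A.pOpcycles (q + 1))) (m.row_d 1 q).symm)
    change (-(m.model.d 2 q 0 (q + 1) ≫ m.ρ (q + 1)) : m.model.X 2 q ⟶ A.homology (q + 1)) ≫
      A.homologyι (q + 1) = m.model.d 2 q 1 q ≫ m.f₁ q ≫ A.pOpcycles (q + 1)
    rw [ρ, Preadditive.neg_comp, Category.assoc, Category.assoc,
      HomologicalComplex.homology_π_ι, HomologicalComplex.liftCycles_i_assoc]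
    have h := congrArg (· ≫ A.pOpcycles (q + 1)) (m.f_two_comp_d q)
    rw [Category.assoc, HomologicalComplex.d_pOpcycles, Limits.comp_zero] at h
    simp only [Category.assoc, Preadditive.add_comp] at h
    exact neg_eq_of_add_eq_zero_right h.symm

lemma toExt_universalMassey [Small.{v} R] (q : ℤ) :
    m.horizontalResolution.toExt (fun q => A.homology q) 2 (-1) m.universalMassey
      ⟨(q, q + 1), by simp⟩ = -(homologyExtension A q).extClass := by
  rw [← (m.homologyExtensionLift q).extMk_φ_eq_extClass, ProjectiveResolution.neg_extMk]
  have h : m.masseyCochain ⟨(q, q + 1), by simp⟩ = -(m.homologyExtensionLift q).φ :=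
    (neg_neg _).symm
  simp only [← h]
  rfl

end MinimalModel

theorem mainTheorem5 {R : Type u} [CommRing R] [Small.{v} R] :
    (InitialOperadAlgebra.forget.{v} R).IsEquivalence ∧
    ∀ A : ChainComplex (ModuleCat.{v} R) ℤ,
      (∀ P : HorizontalResolution (fun q => A.homology q),
        Function.Bijective (P.toExt (fun q => A.homology q) 2 (-1))) ∧
      Nonempty (MinimalModel A) ∧
      ∀ (m : MinimalModel A) (q : ℤ),
        m.horizontalResolution.toExt (fun q => A.homology q) 2 (-1) m.universalMassey
          ⟨(q, q + 1), by simp⟩ = -(homologyExtension A q).extClass := by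
  refine ⟨inferInstance, fun A => ⟨fun P => P.toExt_bijective _ 1 (-1), MinimalModel.nonempty A,
    fun m q => m.toExt_universalMassey q⟩⟩
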